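/- Let $U$ be an ultrafilter on a set $I$, and for a set $X$ let ${}^*X$ denote its ultrapower $X^I/U$; standard objects are transferred to internal ones, and for $z\in{}^*\mathbb C$ and $w\in\mathbb C$ write ${}^\circ z=w$ if $|z-w|<\varepsilon$ for all standard $\varepsilon>0$. Let $\eta\in{}^*\mathbb N$ be infinite. **The space.** Let $\overline{\mathcal R}_\eta=\{\tau\in{}^*\mathbb R:-\eta\le\tau<\eta\}$, let $\mathfrak C_\eta$ be the hyperfinite algebra of internal unions of intervals $[\frac j\eta,\frac{j+1}\eta)$, $-\eta^2\le j<\eta^2$, and let $\lambda_\eta$ be the internal counting measure giving each such interval mass $\frac1\eta$. For $f$ internal and $\mathfrak C_\eta$-measurable (i.e. constant on each interval) and for $A\in\mathfrak C_\eta$, the internal integral is $\int_A f\,d\lambda_\eta=\frac1\eta\sum_{[j/\eta,(j+1)/\eta)\subset A}f(\frac j\eta)$. Let $L(\lambda_\eta)$ be the Loeb measure: the Carathéodory extension of ${}^\circ\lambda_\eta:\mathfrak C_\eta\to[0,\infty]$ to $\sigma(\mathfrak C_\eta)$, completed. Let $st:\overline{\mathcal R}_\eta\to\mathbb R\cup\{\pm\infty\}$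 be the standard part map, with value $\pm\infty$ at infinite points. **S-integrability.** An internal $\mathfrak C_\eta$-measurable $f:\overline{\mathcal R}_\eta\to{}^*\mathbb C$ is S-integrable if (a) $\int_{\overline{\mathcal R}_\eta}|f|\,d\lambda_\eta$ is finite, and $\int_A|f|\,d\lambda_\eta$ is infinitesimal for every $A\in\mathfrak C_\eta$ such that either (b) $\lambda_\eta(A)$ is infinitesimal, or (c) $f$ is infinitesimal at every point of $A$. **Fourier transforms.** For $g$ in the Schwartz space $S(\mathbb R)$ of functions $\mathbb R\to\mathbb C$, put $\hat g(t)=\int_{\mathbb R}g(x)e^{-\pi ixt}\,dx$, and let $\hat g_\infty:\mathbb R\cup\{\pm\infty\}\to\mathbb C$ be the extension of $\hat g$ with $\hat g_\infty(\pm\infty)=0$. With $[\cdot]$ the integer part, let $g_\eta(x)={}^*g(\frac{[\eta x]}\eta)$ and $$\hat g_\eta(t)=\int_{\overline{\mathcal R}_\eta}g_\eta(x)\,{}^*\!\exp\Bigl(-\pi i\,\tfrac{[\eta x]}\eta\,\tfrac{[\eta t]}\eta\Bigr)\,d\lambda_\eta(x)\qquad(t\in\overline{\mathcal R}_\eta).$$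 **Theorem.** Let $g\in S(\mathbb R)$. Then $\hat g_\eta$ is S-integrable on $\overline{\mathcal R}_\eta$. Moreover ${}^\circ\hat g_\eta=\hat g_\infty\circ st$ almost everywhere with respect to $L(\lambda_\eta)$; the functions $\hat g_\infty\circ st$ and $\hat g$ are integrable with respect to $L(\lambda_\eta)$ and to Lebesgue measure $\mu$ respectively; and $${}^\circ\!\int_{\overline{\mathcal R}_\eta}\hat g_\eta\,d\lambda_\eta=\int_{\overline{\mathcal R}_\eta}\hat g_\infty\circ st\;dL(\lambda_\eta)=\int_{\mathbb R}\hat g\,d\mu .$$ -/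

import Mathlib

open Filter MeasureTheory
open scoped ENNReal SchwartzMap

noncomputable section

namespace Loeb

universe u

variable {ι : Type u} {U : Ultrafilter ι}

/-! ### The nonstandard extension

For an ultrafilter `U` on an index type `ι`, the nonstandard extension of a set `X` is the
ultrapower `Germ (U : Filter ι) X`.  An internal set of hyperintegers that is hyperfinite is an
element of `Germ U (Finset ℤ)`; an internal function from the hyperreals to the extension of `E`
is an element of `Germ U (ℝ → E)`.  Standard objects are transferred by the constant embedding. -/

/-- The value at `x` of an internal function `f`. -/
def eval {E : Type*} (f : Germ (U : Filter ι) (ℝ → E)) (x : Germ (U : Filter ι) ℝ) :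
    Germ (U : Filter ι) E :=
  Germ.map₂ (fun f x => f x) f x

/-- `z` is infinitely close to the standard point `w`; that is, `w` is the standard part of `z`. -/
def IsStdPart {E : Type*} [NormedAddCommGroup E] (z : Germ (U : Filter ι) E) (w : E) : Prop :=
  ∀ ε : ℝ, 0 < ε → Germ.map (fun v => ‖v - w‖) z < (ε : Germ (U : Filter ι) ℝ)

/-- The standard part of a hyperreal, with values in the extended reals: `⊤` (resp. `⊥`) at
positive (resp. negative) infinite hyperreals. -/
def st (x : Germ (U : Filter ι) ℝ) : EReal :=
  ⨆ (r : ℝ) (_ : (r : Germ (U : Filter ι) ℝ) ≤ x), (r : EReal)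

/-- The inclusion of the hypernaturals into the hyperreals. -/
def ofNat (n : Germ (U : Filter ι) ℕ) : Germ (U : Filter ι) ℝ := Germ.map (fun k : ℕ => (k : ℝ)) n

/-- The inclusion of the hyperintegers into the hyperreals. -/
def ofInt (n : Germ (U : Filter ι) ℤ) : Germ (U : Filter ι) ℝ := Germ.map (fun k : ℤ => (k : ℝ)) n

/-- The hypernatural number `η` is infinite. -/
def IsInfinite (η : Germ (U : Filter ι) ℕ) : Prop :=
  ∀ n : ℕ, (n : Germ (U : Filter ι) ℕ) < η

/-! ### The hyperfinite measure space -/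

/-- The space of hyperreals `τ` with `-ω/η ≤ τ < ω/η`. -/
def Rbar (ω η : Germ (U : Filter ι) ℕ) : Type u :=
  {τ : Germ (U : Filter ι) ℝ // -(ofNat ω / ofNat η) ≤ τ ∧ τ < ofNat ω / ofNat η}

/-- The hyperfinite set of hyperintegers `j` with `-ω ≤ j < ω`. -/
def interval (ω : Germ (U : Filter ι) ℕ) : Germ (U : Filter ι) (Finset ℤ) :=
  Germ.map (fun a : ℕ => Finset.Ico (-(a : ℤ)) (a : ℤ)) ω

/-- Membership of a hyperinteger in a hyperfinite set. -/
def Mem (j : Germ (U : Filter ι) ℤ) (A : Germ (U : Filter ι) (Finset ℤ)) : Prop :=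
  Germ.LiftRel (fun k S => k ∈ S) j A

/-- `x` lies in the interval `[j/η, (j+1)/η)`. -/
def InCell (η : Germ (U : Filter ι) ℕ) (j : Germ (U : Filter ι) ℤ)
    (x : Germ (U : Filter ι) ℝ) : Prop :=
  ofInt j / ofNat η ≤ x ∧ x < (ofInt j + 1) / ofNat η

/-- The internal union of the intervals `[j/η, (j+1)/η)`, for `j` in the hyperfinite set `A`. -/
def cellUnion (ω η : Germ (U : Filter ι) ℕ) (A : Germ (U : Filter ι) (Finset ℤ)) :
    Set (Rbar ω η) :=
  {x | ∃ j, Mem j A ∧ InCell η j x.1}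

/-- The hyperfinite algebra of internal unions of intervals `[j/η, (j+1)/η)`, `-ω ≤ j < ω`. -/
def cellAlgebra (ω η : Germ (U : Filter ι) ℕ) : Set (Set (Rbar ω η)) :=
  {C | ∃ A, A ≤ interval ω ∧ C = cellUnion ω η A}

/-- The internal counting measure of `cellUnion ω η A`, in which each interval has mass `1/η`. -/
def counting (η : Germ (U : Filter ι) ℕ) (A : Germ (U : Filter ι) (Finset ℤ)) :
    Germ (U : Filter ι) ℝ :=
  Germ.map (fun S : Finset ℤ => (S.card : ℝ)) A / ofNat η

/-! ### The Loeb measure -/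

/-- The standard part of the counting measure, as a set function on the algebra
(with value `∞` on sets outside the algebra). -/
def premeasure (ω η : Germ (U : Filter ι) ℕ) (C : Set (Rbar ω η)) : ℝ≥0∞ :=
  ⨅ (A : Germ (U : Filter ι) (Finset ℤ)) (_ : A ≤ interval ω ∧ C = cellUnion ω η A),
    (st (counting η A)).toENNReal

theorem st_toENNReal_add_le {x y : Germ (U : Filter ι) ℝ} (hx : 0 ≤ x) (hy : 0 ≤ y) :
    (st x).toENNReal + (st y).toENNReal ≤ (st (x + y)).toENNReal := by
  have h0 : ∀ z : Germ (U : Filter ι) ℝ, 0 ≤ z → 0 ≤ st z := fun z hz =>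
    le_iSup₂_of_le (f := fun (r : ℝ) (_ : (r : Germ (U : Filter ι) ℝ) ≤ z) => (r : EReal))
      0 hz (by simp)
  rw [← EReal.toENNReal_add (h0 x hx) (h0 y hy)]
  apply EReal.toENNReal_le_toENNReal
  apply EReal.add_le_of_forall_lt
  intro a ha b hb
  obtain ⟨r, ha⟩ := lt_iSup_iff.1 ha
  obtain ⟨hr, ha⟩ := lt_iSup_iff.1 ha
  obtain ⟨s, hb⟩ := lt_iSup_iff.1 hb
  obtain ⟨hs, hb⟩ := lt_iSup_iff.1 hb
  refine (add_le_add ha.le hb.le).trans ?_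
  rw [← EReal.coe_add]
  exact le_iSup₂_of_le
    (f := fun (r : ℝ) (_ : (r : Germ (U : Filter ι) ℝ) ≤ x + y) => (r : EReal))
    (r + s) (show (r : Germ (U : Filter ι) ℝ) + (s : Germ (U : Filter ι) ℝ) ≤ x + y from
      add_le_add hr hs) le_rfl

theorem st_zero : st (0 : Germ (U : Filter ι) ℝ) = 0 := by
  apply le_antisymm
  · refine iSup₂_le fun r hr => ?_
    have : r ≤ 0 := Germ.const_le_iff.1 hr
    exact_mod_cast this
  · exact le_iSup₂_of_le
      (f := fun (r : ℝ) (_ : (r : Germ (U : Filter ι) ℝ) ≤ 0) => (r : EReal)) 0 le_rfl (by simp)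

theorem cellUnion_empty (ω η : Germ (U : Filter ι) ℕ) :
    cellUnion ω η (((∅ : Finset ℤ) : Germ (U : Filter ι) (Finset ℤ))) = ∅ := by
  ext x
  simp only [cellUnion, Set.mem_ofPred_eq, Set.mem_empty_iff_false, iff_false]
  rintro ⟨j, hj, -⟩
  induction j using Germ.inductionOn with | _ j => ?_
  have hj' : ∀ᶠ i in (U : Filter ι), j i ∈ (∅ : Finset ℤ) := hj
  obtain ⟨i, hi⟩ := hj'.exists
  exact absurd hi (Finset.notMem_empty _)

theorem premeasure_empty (ω η : Germ (U : Filter ι) ℕ) : premeasure ω η ∅ = 0 := by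
  refine le_antisymm ?_ bot_le
  refine iInf₂_le_of_le ((∅ : Finset ℤ) : Germ (U : Filter ι) (Finset ℤ))
    ⟨?_, (cellUnion_empty ω η).symm⟩ ?_
  · induction ω using Germ.inductionOn with | _ a => ?_
    exact Eventually.of_forall fun i => Finset.empty_subset _
  · have : counting η ((∅ : Finset ℤ) : Germ (U : Filter ι) (Finset ℤ)) = 0 := by
      induction η using Germ.inductionOn with | _ n => ?_
      refine Germ.coe_eq.2 (Eventually.of_forall fun i => ?_)
      show ((∅ : Finset ℤ).card : ℝ) / (n i : ℝ) = 0
      simp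
    rw [this, st_zero]; simp

/-- The outer measure generated by the standard part of the counting measure. -/
def outer (ω η : Germ (U : Filter ι) ℕ) : OuterMeasure (Rbar ω η) :=
  OuterMeasure.ofFunction (premeasure ω η) (premeasure_empty ω η)

/-- The intervals `[j/η, (j+1)/η)` are pairwise disjoint. -/
theorem InCell.unique {η : Germ (U : Filter ι) ℕ} {j k : Germ (U : Filter ι) ℤ}
    {x : Germ (U : Filter ι) ℝ} (hj : InCell η j x) (hk : InCell η k x) : j = k := by
  induction η using Germ.inductionOn with | _ n => ?_
  induction j using Germ.inductionOn with | _ j => ?_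
  induction k using Germ.inductionOn with | _ k => ?_
  induction x using Germ.inductionOn with | _ x => ?_
  have h1 : ∀ᶠ i in (U : Filter ι), (j i : ℝ) / n i ≤ x i := hj.1
  have h2 : ∀ᶠ i in (U : Filter ι), x i < ((j i : ℝ) + 1) / n i := Germ.coe_lt.1 hj.2
  have h3 : ∀ᶠ i in (U : Filter ι), (k i : ℝ) / n i ≤ x i := hk.1
  have h4 : ∀ᶠ i in (U : Filter ι), x i < ((k i : ℝ) + 1) / n i := Germ.coe_lt.1 hk.2
  refine Germ.coe_eq.2 ?_
  filter_upwards [h1, h2, h3, h4] with i h1 h2 h3 h4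
  rcases Nat.eq_zero_or_pos (n i) with h | h
  · simp [h] at h1 h2; linarith
  · have hn : (0 : ℝ) < n i := by exact_mod_cast h
    have a1 := (div_lt_div_iff_of_pos_right hn).1 (h1.trans_lt h4)
    have a2 := (div_lt_div_iff_of_pos_right hn).1 (h3.trans_lt h2)
    have b1 : j i < k i + 1 := by exact_mod_cast a1
    have b2 : k i < j i + 1 := by exact_mod_cast a2
    omega

/-- Sets of the algebra are measurable for the outer measure. -/
theorem generateFrom_le (ω η : Germ (U : Filter ι) ℕ) :
    MeasurableSpace.generateFrom (cellAlgebra ω η) ≤ (outer ω η).caratheodory := by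
  refine MeasurableSpace.generateFrom_le ?_
  rintro C ⟨A, hA, rfl⟩
  refine OuterMeasure.ofFunction_caratheodory fun T => ?_
  refine le_iInf₂ ?_
  rintro B ⟨hB, rfl⟩
  have hinter : cellUnion ω η B ∩ cellUnion ω η A =
      cellUnion ω η (Germ.map₂ (fun S T => S ∩ T) B A) := by
    ext x
    constructor
    · rintro ⟨⟨j, hj, hx⟩, k, hk, hx'⟩
      obtain rfl := hx.unique hx'
      refine ⟨j, ?_, hx⟩
      induction j using Germ.inductionOn with | _ j => ?_
      induction A using Germ.inductionOn with | _ A => ?_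
      induction B using Germ.inductionOn with | _ B => ?_
      have hj' : ∀ᶠ i in (U : Filter ι), j i ∈ B i := hj
      have hk' : ∀ᶠ i in (U : Filter ι), j i ∈ A i := hk
      exact (hj'.and hk').mono fun i h => Finset.mem_inter.2 h
    · rintro ⟨j, hj, hx⟩
      induction j using Germ.inductionOn with | _ j => ?_
      induction A using Germ.inductionOn with | _ A => ?_
      induction B using Germ.inductionOn with | _ B => ?_
      have hj' : ∀ᶠ i in (U : Filter ι), j i ∈ B i ∩ A i := hj
      exact ⟨⟨(j : Germ (U : Filter ι) ℤ), hj'.mono fun i h => (Finset.mem_inter.1 h).1, hx⟩,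
        ⟨(j : Germ (U : Filter ι) ℤ), hj'.mono fun i h => (Finset.mem_inter.1 h).2, hx⟩⟩
  have hdiff : cellUnion ω η B \ cellUnion ω η A =
      cellUnion ω η (Germ.map₂ (fun S T => S \ T) B A) := by
    ext x
    constructor
    · rintro ⟨⟨j, hj, hx⟩, hk⟩
      refine ⟨j, ?_, hx⟩
      have hk : ¬ Mem j A := fun h => hk ⟨j, h, hx⟩
      induction j using Germ.inductionOn with | _ j => ?_
      induction A using Germ.inductionOn with | _ A => ?_
      induction B using Germ.inductionOn with | _ B => ?_
      have hj' : ∀ᶠ i in (U : Filter ι), j i ∈ B i := hj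
      have hk' : ∀ᶠ i in (U : Filter ι), ¬ j i ∈ A i := Ultrafilter.eventually_not.2 hk
      exact (hj'.and hk').mono fun i h => Finset.mem_sdiff.2 h
    · rintro ⟨j, hj, hx⟩
      induction j using Germ.inductionOn with | _ j => ?_
      induction A using Germ.inductionOn with | _ A => ?_
      induction B using Germ.inductionOn with | _ B => ?_
      have hj' : ∀ᶠ i in (U : Filter ι), j i ∈ B i \ A i := hj
      refine ⟨⟨(j : Germ (U : Filter ι) ℤ), hj'.mono fun i h => (Finset.mem_sdiff.1 h).1, hx⟩, ?_⟩
      rintro ⟨k, hk, hx'⟩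
      obtain rfl := hx.unique hx'
      have hk' : ∀ᶠ i in (U : Filter ι), j i ∈ A i := hk
      obtain ⟨i, h1, h2⟩ := (hj'.and hk').exists
      exact (Finset.mem_sdiff.1 h1).2 h2
  rw [hinter, hdiff]
  have h1 : premeasure ω η (cellUnion ω η (Germ.map₂ (fun S T => S ∩ T) B A)) ≤
      (st (counting η (Germ.map₂ (fun S T => S ∩ T) B A))).toENNReal := by
    refine iInf₂_le _ ⟨?_, rfl⟩
    refine le_trans ?_ hB
    induction A using Germ.inductionOn with | _ A => ?_
    induction B using Germ.inductionOn with | _ B => ?_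
    exact Eventually.of_forall fun i => Finset.inter_subset_left
  have h2 : premeasure ω η (cellUnion ω η (Germ.map₂ (fun S T => S \ T) B A)) ≤
      (st (counting η (Germ.map₂ (fun S T => S \ T) B A))).toENNReal := by
    refine iInf₂_le _ ⟨?_, rfl⟩
    refine le_trans ?_ hB
    induction A using Germ.inductionOn with | _ A => ?_
    induction B using Germ.inductionOn with | _ B => ?_
    exact Eventually.of_forall fun i => Finset.sdiff_subset
  have hpos : ∀ D, 0 ≤ counting η D := by
    intro D
    induction D using Germ.inductionOn with | _ D => ?_
    induction η using Germ.inductionOn with | _ n => ?_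
    exact Eventually.of_forall fun i => by
      show (0 : ℝ) ≤ ((D i).card : ℝ) / (n i : ℝ)
      positivity
  have hadd : counting η (Germ.map₂ (fun S T => S ∩ T) B A) +
      counting η (Germ.map₂ (fun S T => S \ T) B A) = counting η B := by
    induction A using Germ.inductionOn with | _ A => ?_
    induction B using Germ.inductionOn with | _ B => ?_
    induction η using Germ.inductionOn with | _ n => ?_
    refine Germ.coe_eq.2 (Eventually.of_forall fun i => ?_)
    show ((B i ∩ A i).card : ℝ) / (n i : ℝ) + ((B i \ A i).card : ℝ) / (n i : ℝ) =
      ((B i).card : ℝ) / (n i : ℝ)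
    rw [← add_div, ← Nat.cast_add, Finset.card_inter_add_card_sdiff]
  calc _ ≤ _ := add_le_add h1 h2
    _ ≤ _ := st_toENNReal_add_le (hpos _) (hpos _)
    _ = _ := by rw [hadd]

/-- The extension of the standard part of the counting measure to the `σ`-algebra generated by
the algebra `cellAlgebra ω η`. -/
def sigmaMeasure (ω η : Germ (U : Filter ι) ℕ) :
    @Measure (Rbar ω η) (MeasurableSpace.generateFrom (cellAlgebra ω η)) :=
  @OuterMeasure.toMeasure (Rbar ω η) (MeasurableSpace.generateFrom (cellAlgebra ω η))
    (outer ω η) (generateFrom_le ω η)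

/-- The Loeb `σ`-algebra: the completion of the generated `σ`-algebra. -/
instance loebSpace (ω η : Germ (U : Filter ι) ℕ) : MeasurableSpace (Rbar ω η) :=
  @NullMeasurableSpace.instMeasurableSpace (Rbar ω η)
    (MeasurableSpace.generateFrom (cellAlgebra ω η)) (sigmaMeasure ω η)

/-- The Loeb measure, on the completed `σ`-algebra. -/
def loebMeasure (ω η : Germ (U : Filter ι) ℕ) : Measure (Rbar ω η) :=
  @Measure.completion (Rbar ω η)
    (MeasurableSpace.generateFrom (cellAlgebra ω η)) (sigmaMeasure ω η)

/-! ### Internal integration and S-integrability -/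

/-- The sum `(1/n) ∑_{j ∈ A} f (j/n)`. -/
def gridSum {E : Type*} [AddCommGroup E] [Module ℝ E] (n : ℕ) (A : Finset ℤ) (f : ℝ → E) : E :=
  (1 / (n : ℝ)) • ∑ j ∈ A, f ((j : ℝ) / (n : ℝ))

/-- The internal integral of the internal function `f`, with respect to the counting measure,
over the internal union of the intervals `[j/η, (j+1)/η)`, `j ∈ A`. -/
def internalIntegral {E : Type*} [AddCommGroup E] [Module ℝ E] (η : Germ (U : Filter ι) ℕ)
    (A : Germ (U : Filter ι) (Finset ℤ)) (f : Germ (U : Filter ι) (ℝ → E)) :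
    Germ (U : Filter ι) E :=
  Germ.map₂ (fun I f => I f) (Germ.map₂ (fun n S => gridSum n S) η A) f

/-- The internal function `|f|`. -/
def absFun (f : Germ (U : Filter ι) (ℝ → ℂ)) : Germ (U : Filter ι) (ℝ → ℝ) :=
  Germ.map (fun f x => ‖f x‖) f

/-- `f` is measurable for the hyperfinite algebra, i.e. constant on each interval
`[j/η, (j+1)/η)`, `-ω ≤ j < ω`. -/
def IsCellMeasurable (ω η : Germ (U : Filter ι) ℕ) (f : Germ (U : Filter ι) (ℝ → ℂ)) : Prop :=
  ∀ j, Mem j (interval ω) → ∀ x, InCell η j x → eval f x = eval f (ofInt j / ofNat η)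

/-- S-integrability, on the (possibly infinite) hyperfinite measure space `Rbar ω η`. -/
structure SIntegrable (ω η : Germ (U : Filter ι) ℕ) (f : Germ (U : Filter ι) (ℝ → ℂ)) :
    Prop where
  measurable : IsCellMeasurable ω η f
  finite : ∃ C : ℝ, internalIntegral η (interval ω) (absFun f) ≤ (C : Germ (U : Filter ι) ℝ)
  small_of_null : ∀ A, A ≤ interval ω → IsStdPart (counting η A) 0 →
    IsStdPart (internalIntegral η A (absFun f)) 0
  small_of_infinitesimal : ∀ A, A ≤ interval ω →
    (∀ x ∈ cellUnion ω η A, IsStdPart (eval f x.1) 0) →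
    IsStdPart (internalIntegral η A (absFun f)) 0

/-! ### Fourier transforms -/

/-- The Fourier transform, normalized by `exp (-π i x t)`. -/
def fourier (g : ℝ → ℂ) (t : ℝ) : ℂ :=
  ∫ x : ℝ, g x * Complex.exp (-(Real.pi * Complex.I * x * t))

/-- The extension of a function on the reals by `0` at `⊤` and `⊥`. -/
def extendZero (h : ℝ → ℂ) (y : EReal) : ℂ :=
  if y = ⊤ ∨ y = ⊥ then 0 else h y.toReal

/-- Rounding down to the grid of mesh `1/n`. -/
def gridFloor (n : ℕ) (x : ℝ) : ℝ := (⌊(n : ℝ) * x⌋ : ℝ) / (n : ℝ)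

/-- The measurable counterpart `x ↦ *g ([ηx]/η)` of the transfer of a standard function `g`. -/
def discretize (η : Germ (U : Filter ι) ℕ) (g : ℝ → ℂ) : Germ (U : Filter ι) (ℝ → ℂ) :=
  Germ.map (fun n x => g (gridFloor n x)) η

/-- The integrand `x ↦ f x * exp (-π i ([nx]/n) ([nt]/n))`. -/
def dftIntegrand (n : ℕ) (f : ℝ → ℂ) (t x : ℝ) : ℂ :=
  f x * Complex.exp (-(Real.pi * Complex.I * gridFloor n x * gridFloor n t))

/-- The internal discrete Fourier transform, an internal integral over `Rbar (η ^ 2) η`: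
`t ↦ (1/η) ∑_{-η² ≤ j < η²} f (j/η) * exp (-π i (j/η) ([ηt]/η))`. -/
def dft (η : Germ (U : Filter ι) ℕ) (f : Germ (U : Filter ι) (ℝ → ℂ)) :
    Germ (U : Filter ι) (ℝ → ℂ) :=
  Germ.map₂ (fun n f t =>
    gridSum n (Finset.Ico (-((n ^ 2 : ℕ) : ℤ)) ((n ^ 2 : ℕ) : ℤ)) (dftIntegrand n f t)) η f

end Loeb

end

namespace Loeb

/-! Everything reduces to one estimate at finite level: for large `n` the discrete transform on the
grid of mesh `1/n` in `[-n, n)` is bounded by `C / (1 + t ^ 2)` with `C` independent of `n`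
(`exists_norm_gridFourier_le`). It comes from summing by parts twice, the discrete form of
integrating by parts twice against the exponential.

A grid sum is the Lebesgue integral of a step function, so dominated convergence (`tendsto_gridSum`)
yields both the convergence of the discrete transforms to `fourier g`, jointly in `n` and `t`, and
that of their grid sums to the integral of `fourier g`. An ultrafilter need not be countably
generated, so these limits are taken along `atTop` or a product of `atTop` with a neighbourhood
filter, and only then composed with a representative of `η`, which tends to `atTop` along `U`.

Standard parts are limits along `U`. The uniform bound therefore gives S-integrability
(`sIntegrable_of_norm_le`) and makes the transform infinitesimal at infinite points; at finite
points the joint limit applies (`isStdPart_gridFourier`).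

On the measure side, countable saturation shows that the Loeb measure of an internal union of cells
is the standard part of its counting measure (`outer_cellUnion`). Hence the standard part map
carries the Loeb measure on finite points to Lebesgue measure (`map_toReal_st`), and the Loeb
integral is a change of variables. -/

/-! ### Grid sums and dominated convergence. -/

theorem gridFloor_div {n : ℕ} (hn : 0 < n) (j : ℤ) : gridFloor n ((j : ℝ) / n) = (j : ℝ) / n := by
  have : (n : ℝ) ≠ 0 := by positivity
  rw [gridFloor, mul_div_cancel₀ _ this, Int.floor_intCast]

theorem gridFloor_le {n : ℕ} (hn : 0 < n) (x : ℝ) : gridFloor n x ≤ x := by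
  have : (0 : ℝ) < n := by positivity
  rw [gridFloor, div_le_iff₀ this, mul_comm]
  exact Int.floor_le _

theorem lt_gridFloor_add {n : ℕ} (hn : 0 < n) (x : ℝ) : x < gridFloor n x + 1 / n := by
  have : (0 : ℝ) < n := by positivity
  rw [gridFloor, ← add_div, lt_div_iff₀ this, mul_comm]
  exact Int.lt_floor_add_one _

theorem abs_gridFloor_sub_le {n : ℕ} (hn : 0 < n) (x : ℝ) : |gridFloor n x - x| ≤ 1 / n := by
  have := gridFloor_le hn x
  have := lt_gridFloor_add hn x
  rw [abs_le]; constructor <;> linarith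

theorem measurableSet_floor_mem (n : ℕ) (A : Finset ℤ) :
    MeasurableSet {x : ℝ | ⌊(n : ℝ) * x⌋ ∈ A} :=
  (Int.measurable_floor.comp (measurable_const_mul (n : ℝ))) A.measurableSet

theorem stronglyMeasurable_comp_gridFloor {E : Type*} [NormedAddCommGroup E] (n : ℕ) (f : ℝ → E) :
    StronglyMeasurable fun x => f (gridFloor n x) :=
  (StronglyMeasurable.of_discrete (f := fun j : ℤ => f ((j : ℝ) / n))).comp_measurable
    (Int.measurable_floor.comp (measurable_const_mul (n : ℝ)))

/-- A grid sum is the integral of a step function. -/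
theorem gridSum_eq_setIntegral {E : Type*} [NormedAddCommGroup E] [NormedSpace ℝ E]
    [CompleteSpace E] {n : ℕ} (hn : 0 < n) (A : Finset ℤ) (f : ℝ → E) :
    gridSum n A f = ∫ x in {x : ℝ | ⌊(n : ℝ) * x⌋ ∈ A}, f (gridFloor n x) := by
  have hn' : (0 : ℝ) < n := by positivity
  have hcell : ∀ (j : ℤ) (x : ℝ), x ∈ Set.Ico ((j : ℝ) / n) (((j : ℝ) + 1) / n) ↔
      ⌊(n : ℝ) * x⌋ = j := by
    intro j x
    rw [Int.floor_eq_iff, Set.mem_Ico, div_le_iff₀ hn', lt_div_iff₀ hn', mul_comm x]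
  have hset : {x : ℝ | ⌊(n : ℝ) * x⌋ ∈ A} =
      ⋃ j ∈ A, Set.Ico ((j : ℝ) / n) (((j : ℝ) + 1) / n) := by
    ext x
    simp only [Set.mem_iUnion, hcell, Set.mem_ofPred_eq, exists_prop, exists_eq_right']
  have hval : ∀ j : ℤ, Set.EqOn (fun x => f (gridFloor n x)) (fun _ => f ((j : ℝ) / n))
      (Set.Ico ((j : ℝ) / n) (((j : ℝ) + 1) / n)) := by
    intro j x hx
    simp only [gridFloor, (hcell j x).1 hx]
  rw [hset, integral_biUnion_finset A (fun j _ => measurableSet_Ico)]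
  · rw [gridSum, Finset.smul_sum]
    refine Finset.sum_congr rfl fun j _ => ?_
    rw [setIntegral_congr_fun measurableSet_Ico (hval j), setIntegral_const]
    congr 1
    rw [Measure.real, Real.volume_Ico, ENNReal.toReal_ofReal]
    · ring
    · rw [← sub_div]; ring_nf; positivity
  · intro j _ k _ hjk
    rw [Function.onFun, Set.disjoint_left]
    intro x hx hx'
    exact hjk (((hcell j x).1 hx).symm.trans ((hcell k x).1 hx'))
  · intro j _
    refine IntegrableOn.congr_fun ?_ (hval j).symm measurableSet_Ico
    exact integrableOn_const (by simp)

/-- Moves the weight `1 / (1 + x ^ 2)` to a nearby point at the cost of a constant. It follows from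
`x² + (y + (y - x))² = 2y² + 2(y - x)²`. -/
theorem one_add_sq_le {x y c : ℝ} (hc : 1 ≤ c) (h : |y - x| ≤ c) :
    1 + x ^ 2 ≤ 4 * c ^ 2 * (1 + y ^ 2) := by
  have h2 := sq_le_sq' (by linarith [(abs_le.1 h).1]) (abs_le.1 h).2
  nlinarith [sq_nonneg (y + (y - x)), sq_nonneg y, mul_le_mul hc hc zero_le_one (by linarith),
    mul_nonneg (sub_nonneg.2 (one_le_pow₀ (n := 2) hc)) (sq_nonneg y)]

/-- Dominated convergence for grid sums over `[-n, n)`. -/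
theorem tendsto_gridSum {E α : Type*} [NormedAddCommGroup E] [NormedSpace ℝ E] [CompleteSpace E]
    {l : Filter α} [l.IsCountablyGenerated] {n : α → ℕ} (hn : Tendsto n l atTop)
    {h : α → ℝ → E} {H : ℝ → E} {C : ℝ}
    (hbound : ∀ᶠ a in l, ∀ k ∈ Finset.Ico (-((n a ^ 2 : ℕ) : ℤ)) ((n a ^ 2 : ℕ) : ℤ),
      ‖h a ((k : ℝ) / n a)‖ ≤ C / (1 + ((k : ℝ) / n a) ^ 2))
    (hlim : ∀ x, Tendsto (fun a => h a (gridFloor (n a) x)) l (nhds (H x))) :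
    Tendsto (fun a => gridSum (n a)
      (Finset.Ico (-((n a ^ 2 : ℕ) : ℤ)) ((n a ^ 2 : ℕ) : ℤ)) (h a)) l (nhds (∫ x, H x)) := by
  set S : α → Set ℝ := fun a =>
    {x : ℝ | ⌊(n a : ℝ) * x⌋ ∈ Finset.Ico (-((n a ^ 2 : ℕ) : ℤ)) ((n a ^ 2 : ℕ) : ℤ)} with hS
  have hS' : ∀ a, MeasurableSet (S a) := fun a => measurableSet_floor_mem _ _
  have hpos : ∀ᶠ a in l, 0 < n a := hn.eventually_gt_atTop 0
  have heq : ∀ᶠ a in l, ∫ x, (S a).indicator (fun x => h a (gridFloor (n a) x)) x =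
      gridSum (n a) (Finset.Ico (-((n a ^ 2 : ℕ) : ℤ)) ((n a ^ 2 : ℕ) : ℤ)) (h a) := by
    filter_upwards [hpos] with a ha
    rw [gridSum_eq_setIntegral ha, integral_indicator (hS' a)]
  refine Tendsto.congr' heq ?_
  -- The hypothesis bounds `h a` at the grid point below `x`, at distance at most 1; replacing that
  -- point by `x` costs the factor 4. The absolute value is there because `C` has no assumed sign.
  refine tendsto_integral_filter_of_dominated_convergence (fun x => 4 * |C| * (1 + x ^ 2)⁻¹) ?_ ?_
    (integrable_inv_one_add_sq.const_mul _) ?_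
  · exact Eventually.of_forall fun a =>
      ((stronglyMeasurable_comp_gridFloor _ _).indicator (hS' a)).aestronglyMeasurable
  · filter_upwards [hpos, hbound] with a ha hb
    refine Eventually.of_forall fun x => ?_
    by_cases hx : x ∈ S a
    · rw [Set.indicator_of_mem hx]
      refine (hb _ hx).trans ?_
      change C / (1 + gridFloor (n a) x ^ 2) ≤ _
      have h1 : |gridFloor (n a) x - x| ≤ 1 := (abs_gridFloor_sub_le ha x).trans (by
        rw [div_le_one (by positivity)]; exact_mod_cast ha)
      have h2 := one_add_sq_le le_rfl h1
      rw [div_le_iff₀ (by positivity)]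
      have h3 : 1 ≤ 4 * (1 + x ^ 2)⁻¹ * (1 + gridFloor (n a) x ^ 2) := by
        rw [mul_right_comm, ← div_eq_mul_inv, one_le_div (by positivity)]
        linarith
      calc C ≤ |C| * 1 := by rw [mul_one]; exact le_abs_self C
        _ ≤ |C| * (4 * (1 + x ^ 2)⁻¹ * (1 + gridFloor (n a) x ^ 2)) := by gcongr
        _ = _ := by ring
    · rw [Set.indicator_of_notMem hx, norm_zero]; positivity
  · refine Eventually.of_forall fun x => (hlim x).congr' ?_
    -- Once `n a > |x|`, the point `x` lies in the window `[-n a, n a)` and the indicator is 1.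
    filter_upwards [hn.eventually_gt_atTop ⌈|x|⌉₊, hpos] with a ha ha0
    rw [Set.indicator_of_mem]
    have h0 : (0 : ℝ) < n a := by positivity
    have h1 : |x| < n a := Nat.lt_of_ceil_lt ha
    rw [abs_lt] at h1
    simp only [hS, Set.mem_ofPred_eq, Finset.mem_Ico, Int.le_floor, Int.floor_lt]
    push_cast
    constructor <;> nlinarith [h1.1, h1.2]

theorem tendsto_gridFloor {α : Type*} {l : Filter α} {n : α → ℕ} (hn : Tendsto n l atTop)
    {x : α → ℝ} {y : ℝ} (hx : Tendsto x l (nhds y)) :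
    Tendsto (fun a => gridFloor (n a) (x a)) l (nhds y) := by
  have h : Tendsto (fun a => gridFloor (n a) (x a) - x a) l (nhds 0) := by
    refine squeeze_zero_norm' ?_ ((tendsto_one_div_atTop_nhds_zero_nat (𝕜 := ℝ)).comp hn)
    filter_upwards [hn.eventually_gt_atTop 0] with a ha
    exact abs_gridFloor_sub_le ha _
  simpa using h.add hx

/-- The sums converge to `π < 4`. -/
theorem eventually_gridSum_le :
    ∀ᶠ n : ℕ in atTop, gridSum n (Finset.Ico (-((n ^ 2 : ℕ) : ℤ)) ((n ^ 2 : ℕ) : ℤ))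
      (fun x => 1 / (1 + x ^ 2)) ≤ 4 := by
  have h : Tendsto (fun n : ℕ => gridSum n (Finset.Ico (-((n ^ 2 : ℕ) : ℤ)) ((n ^ 2 : ℕ) : ℤ))
      (fun x : ℝ => 1 / (1 + x ^ 2))) atTop (nhds (∫ x : ℝ, 1 / (1 + x ^ 2))) := by
    refine tendsto_gridSum tendsto_id (C := 1) (Eventually.of_forall fun n k _ => ?_) fun x => ?_
    · rw [Real.norm_of_nonneg (by positivity)]
    · have hc : Continuous fun x : ℝ => 1 / (1 + x ^ 2) :=
        continuous_const.div (by fun_prop) fun x => by positivity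
      exact (hc.tendsto x).comp (tendsto_gridFloor tendsto_id tendsto_const_nhds)
  refine h.eventually_le_const ?_
  simp only [one_div, integral_univ_inv_one_add_sq]
  exact Real.pi_lt_four

/-! ### The discrete transform at finite level and its limit. -/

/-- The discrete Fourier transform of the restriction of `g` to the grid of mesh `1/n`. -/
noncomputable def gridFourier (g : ℝ → ℂ) (n : ℕ) (t : ℝ) : ℂ :=
  gridSum n (Finset.Ico (-((n ^ 2 : ℕ) : ℤ)) ((n ^ 2 : ℕ) : ℤ))
    (dftIntegrand n (fun x => g (gridFloor n x)) t)

theorem exists_norm_le_div (g : 𝓢(ℝ, ℂ)) : ∃ C, 0 < C ∧ ∀ x, ‖g x‖ ≤ C / (1 + x ^ 2) := by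
  obtain ⟨C₀, h0, hC₀⟩ := g.decay 0 0
  obtain ⟨C₂, h2, hC₂⟩ := g.decay 2 0
  refine ⟨C₀ + C₂, by positivity, fun x => ?_⟩
  have h0 := hC₀ x
  have h2 := hC₂ x
  simp only [norm_iteratedFDeriv_zero, pow_zero, one_mul, Real.norm_eq_abs, sq_abs] at h0 h2
  rw [le_div_iff₀ (by positivity)]
  linarith

theorem norm_exp_neg_pi_mul (x t : ℝ) :
    ‖Complex.exp (-(Real.pi * Complex.I * x * t))‖ = 1 := by
  have : -(Real.pi * Complex.I * x * t : ℂ) = ((-(Real.pi * x * t) : ℝ) : ℂ) * Complex.I := by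
    push_cast; ring
  rw [this, Complex.norm_exp_ofReal_mul_I]

/-- The limit is joint in the mesh and the frequency so that it can be composed with a frequency
that varies with the index and only converges to `t`. -/
theorem tendsto_gridFourier (g : 𝓢(ℝ, ℂ)) (t : ℝ) :
    Tendsto (fun p : ℕ × ℝ => gridFourier g p.1 p.2) (atTop ×ˢ nhds t)
      (nhds (fourier g t)) := by
  obtain ⟨C, -, hC⟩ := exists_norm_le_div g
  have hn : Tendsto (Prod.fst : ℕ × ℝ → ℕ) (atTop ×ˢ nhds t) atTop := tendsto_fst
  refine tendsto_gridSum hn (C := C) ?_ fun x => ?_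
  · filter_upwards [hn.eventually_gt_atTop 0] with p hp k _
    rw [dftIntegrand, norm_mul, norm_exp_neg_pi_mul, mul_one, gridFloor_div hp]
    exact hC _
  · have h1 := tendsto_gridFloor hn (tendsto_const_nhds (x := x))
    -- Two roundings are nested: one in the discretized `g` and the phase, one from evaluating the
    -- integrand on the grid.
    have h2 := tendsto_gridFloor hn h1
    have h3 := tendsto_gridFloor hn (tendsto_snd (f := (atTop : Filter ℕ)) (g := nhds t))
    refine ((g.continuous.tendsto x).comp h2).mul ?_
    refine (Complex.continuous_exp.tendsto _).comp (Tendsto.neg ?_)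
    exact (tendsto_const_nhds.mul ((Complex.continuous_ofReal.tendsto _).comp h2)).mul
      ((Complex.continuous_ofReal.tendsto _).comp h3)

/-- Mathlib's kernel is `exp (-2πixξ)`, so this transform is the Schwartz one at `ξ = t / 2`. -/
theorem integrable_fourier (g : 𝓢(ℝ, ℂ)) : Integrable (fourier g) := by
  have h : fourier g = fun t => (FourierTransform.fourier g : 𝓢(ℝ, ℂ)) (t * 2⁻¹) := by
    funext t
    rw [SchwartzMap.fourier_coe, Real.fourier_real_eq_integral_exp_smul, fourier]
    refine integral_congr_ae (Eventually.of_forall fun x => ?_)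
    simp only [smul_eq_mul]
    rw [mul_comm]
    congr 2
    push_cast
    ring
  rw [h]
  exact (FourierTransform.fourier g : 𝓢(ℝ, ℂ)).integrable.comp_mul_right' (by norm_num)

/-! ### Summation by parts and uniform decay of the discrete transform. -/

theorem sum_Ico_neg_sub {E : Type*} [AddCommGroup E] (F : ℤ → E) (N : ℕ) :
    ∑ j ∈ Finset.Ico (-(N : ℤ)) (N : ℤ), (F (j + 1) - F j) = F N - F (-N) := by
  have h : ∀ (a : ℤ) (m : ℕ), ∑ j ∈ Finset.Ico a (a + m), (F (j + 1) - F j) = F (a + m) - F a := by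
    intro a m
    induction m with
    | zero => simp
    | succ m ih =>
      have : Finset.Ico a (a + (m + 1 : ℕ)) = insert (a + m) (Finset.Ico a (a + m)) := by
        ext j; simp only [Finset.mem_Ico, Finset.mem_insert]; omega
      rw [this, Finset.sum_insert (by simp), ih]
      push_cast
      rw [add_assoc]; abel
  have := h (-N) (2 * N)
  have e : -(N : ℤ) + ((2 * N : ℕ) : ℤ) = N := by push_cast; ring
  rwa [e] at this

/-- Summation by parts on a symmetric interval of integers. -/
theorem sub_one_mul_sum_zpow (a : ℤ → ℂ) {z : ℂ} (hz : z ≠ 0) (N : ℕ) :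
    (z - 1) * ∑ j ∈ Finset.Ico (-(N : ℤ)) (N : ℤ), a j * z ^ j =
      ∑ j ∈ Finset.Ico (-(N : ℤ)) (N : ℤ), (a (j - 1) - a j) * z ^ j +
        (a (N - 1) * z ^ (N : ℤ) - a (-N - 1) * z ^ (-(N : ℤ))) := by
  rw [← sum_Ico_neg_sub (fun j => a (j - 1) * z ^ j), ← Finset.sum_add_distrib, Finset.mul_sum]
  refine Finset.sum_congr rfl fun j _ => ?_
  rw [add_sub_cancel_right, zpow_add₀ hz, zpow_one]
  ring

/-- Each use trades a factor `z - 1` for a difference of the coefficients, up to boundary terms; it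
is applied to `a` and then to its differences. -/
theorem norm_sub_one_mul_norm_sum_zpow_le (a : ℤ → ℂ) {z : ℂ} (hz : ‖z‖ = 1) (N : ℕ) :
    ‖z - 1‖ * ‖∑ j ∈ Finset.Ico (-(N : ℤ)) (N : ℤ), a j * z ^ j‖ ≤
      ‖∑ j ∈ Finset.Ico (-(N : ℤ)) (N : ℤ), (a (j - 1) - a j) * z ^ j‖ +
        (‖a (N - 1)‖ + ‖a (-N - 1)‖) := by
  have hz0 : z ≠ 0 := norm_ne_zero_iff.1 (by rw [hz]; exact one_ne_zero)
  rw [← norm_mul, sub_one_mul_sum_zpow a hz0]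
  refine (norm_add_le _ _).trans (add_le_add le_rfl ((norm_sub_le _ _).trans ?_))
  simp [hz]

theorem norm_sub_le_of_hasDerivAt {F F' : ℝ → ℂ} (hF : ∀ y, HasDerivAt F (F' y) y) {x h B : ℝ}
    (hh : 0 ≤ h) (hB : ∀ y ∈ Set.Icc (x - h) x, ‖F' y‖ ≤ B) : ‖F (x - h) - F x‖ ≤ B * h := by
  have := (convex_Icc (x - h) x).norm_image_sub_le_of_norm_hasDerivWithin_le
    (fun y _ => (hF y).hasDerivWithinAt) hB (Set.right_mem_Icc.2 (by linarith))
    (Set.left_mem_Icc.2 (by linarith))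
  rwa [sub_sub_cancel_left, norm_neg, Real.norm_of_nonneg hh] at this

/-- The mean value inequality is applied twice, and the second derivative of `g` is again Schwartz.
-/
theorem exists_norm_second_difference_le (g : 𝓢(ℝ, ℂ)) : ∃ K, 0 < K ∧ ∀ x h : ℝ, 0 ≤ h → h ≤ 1 →
    ‖(g (x - h - h) - g (x - h)) - (g (x - h) - g x)‖ ≤ K * h ^ 2 / (1 + x ^ 2) := by
  set g₁ : 𝓢(ℝ, ℂ) := SchwartzMap.derivCLM ℂ ℂ g with hg₁
  set g₂ : 𝓢(ℝ, ℂ) := SchwartzMap.derivCLM ℂ ℂ g₁ with hg₂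
  have d1 : ∀ y, HasDerivAt g (g₁ y) y := fun y => g.differentiableAt.hasDerivAt
  have d2 : ∀ y, HasDerivAt g₁ (g₂ y) y := fun y => g₁.differentiableAt.hasDerivAt
  obtain ⟨C, hC0, hC⟩ := exists_norm_le_div g₂
  refine ⟨16 * C, by positivity, fun x h h0 h1 => ?_⟩
  have key : ∀ y ∈ Set.Icc (x - h) x, ‖g₁ (y - h) - g₁ y‖ ≤ 16 * C / (1 + x ^ 2) * h := by
    intro y hy
    refine norm_sub_le_of_hasDerivAt d2 h0 fun u hu => (hC u).trans ?_
    -- The points `u` lie within `2h ≤ 2` of `x`, whence the factor `16 = 4 * 2 ^ 2`.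
    have := one_add_sq_le (x := x) (y := u) (c := 2) (by norm_num) (by
      rw [abs_le]; constructor <;> linarith [hy.1, hy.2, hu.1, hu.2])
    rw [div_le_div_iff₀ (by positivity) (by positivity)]
    nlinarith
  have := norm_sub_le_of_hasDerivAt (F := fun y => g (y - h) - g y)
    (fun y => ((d1 (y - h)).comp_sub_const y h).sub (d1 y)) h0 key
  refine this.trans (le_of_eq ?_)
  ring

theorem gridFourier_eq (g : ℝ → ℂ) {n : ℕ} (hn : 0 < n) (k : ℤ) :
    gridFourier g n ((k : ℝ) / n) = (1 / (n : ℝ)) •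
      ∑ j ∈ Finset.Ico (-((n ^ 2 : ℕ) : ℤ)) ((n ^ 2 : ℕ) : ℤ), g ((j : ℝ) / n) *
        Complex.exp (Complex.I * ((-(Real.pi * k / n ^ 2) : ℝ) : ℂ)) ^ j := by
  rw [gridFourier, gridSum]
  congr 1
  refine Finset.sum_congr rfl fun j _ => ?_
  have : (n : ℂ) ≠ 0 := by exact_mod_cast hn.ne'
  rw [dftIntegrand, gridFloor_div hn, gridFloor_div hn, ← Complex.exp_int_mul]
  congr 2
  push_cast
  field_simp

/-- The left-hand side bounds `2|sin (πk / 2n²)|` from below by Jordan's inequality. This needs the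
angle to be at most `π / 2`, that is `|k| ≤ n²`: the frequency window is exactly one period of the
discrete transform. -/
theorem le_norm_exp_sub_one {n : ℕ} (hn : 0 < n) {k : ℤ}
    (hk : k ∈ Finset.Ico (-((n ^ 2 : ℕ) : ℤ)) ((n ^ 2 : ℕ) : ℤ)) :
    2 * |(k : ℝ)| / n ^ 2 ≤
      ‖Complex.exp (Complex.I * ((-(Real.pi * k / n ^ 2) : ℝ) : ℂ)) - 1‖ := by
  rw [Complex.norm_exp_I_mul_ofReal_sub_one, norm_mul, Real.norm_ofNat, Real.norm_eq_abs, mul_div_assoc]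
  gcongr
  have hn' : (0 : ℝ) < n ^ 2 := by positivity
  have hk' : |(k : ℝ)| ≤ n ^ 2 := by
    rw [Finset.mem_Ico] at hk
    rw [abs_le]
    constructor
    · exact_mod_cast hk.1
    · exact_mod_cast hk.2.le
  have e : |-(Real.pi * k / n ^ 2) / 2| = Real.pi / 2 * (|(k : ℝ)| / n ^ 2) := by
    rw [neg_div, abs_neg, abs_div, abs_div, abs_mul, abs_of_pos Real.pi_pos, abs_of_pos hn',
      abs_two]
    ring
  have := Real.mul_abs_le_abs_sin (x := -(Real.pi * k / n ^ 2) / 2) (by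
    rw [e]
    exact mul_le_of_le_one_right (by positivity) ((div_le_one hn').2 hk'))
  rw [e] at this
  refine le_trans (le_of_eq ?_) this
  have := Real.pi_pos.ne'
  field_simp

/-- Let `S` be the exponential sum, so that the transform has norm `‖S‖ / n`. Two summations by
parts bound `‖z - 1‖ ^ 2 * ‖S‖` by second differences, which total `O(1/n)`, plus boundary terms
`O(1/n²)`. Since `‖z - 1‖ ≥ 2|k| / n²`, this controls `(k/n) ^ 2 * ‖S‖ / n`; the trivial bound
controls `‖S‖ / n` itself. -/
theorem exists_norm_gridFourier_le (g : 𝓢(ℝ, ℂ)) : ∃ C, 0 < C ∧ ∀ᶠ n : ℕ in atTop,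
    ∀ k ∈ Finset.Ico (-((n ^ 2 : ℕ) : ℤ)) ((n ^ 2 : ℕ) : ℤ),
      ‖gridFourier g n ((k : ℝ) / n)‖ ≤ C / (1 + ((k : ℝ) / n) ^ 2) := by
  obtain ⟨C, hC0, hC⟩ := exists_norm_le_div g
  obtain ⟨K, hK0, hK⟩ := exists_norm_second_difference_le g
  -- `4 * C` is the trivial bound; the other term is the bound after two summations by parts,
  -- divided by the 4 from squaring `2|k| / n²`.
  refine ⟨4 * C + (32 * C + 4 * K) / 4, by positivity, ?_⟩
  filter_upwards [eventually_gridSum_le, eventually_ge_atTop 2] with n hsum hn2 k hk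
  have hn : 0 < n := by omega
  have hn' : (0 : ℝ) < n := by positivity
  have hn1 : (1 : ℝ) ≤ n := by exact_mod_cast hn
  set N : ℕ := n ^ 2 with hN
  have hN4 : 4 ≤ N := by nlinarith
  set z := Complex.exp (Complex.I * ((-(Real.pi * k / n ^ 2) : ℝ) : ℂ)) with hz
  have hz1 : ‖z‖ = 1 := by rw [hz, mul_comm, Complex.norm_exp_ofReal_mul_I]
  set a : ℤ → ℂ := fun j => g ((j : ℝ) / n) with ha
  have hweight : ∑ j ∈ Finset.Ico (-(N : ℤ)) (N : ℤ), (1 : ℝ) / (1 + ((j : ℝ) / n) ^ 2) ≤ 4 * (n : ℝ) := by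
    rw [gridSum, smul_eq_mul, one_div, inv_mul_le_iff₀ hn'] at hsum
    linarith
  -- Differencing reaches inwards to index `N - 2`. As `N ≥ 4`, such indices have `|j / n| ≥ n / 2`,
  -- where `g` is at most `4C / n²`.
  have hedge : ∀ j : ℤ, (N : ℤ) - 2 ≤ |j| → ‖a j‖ ≤ 4 * C / n ^ 2 := by
    intro j hj
    refine (hC _).trans ?_
    have hj' : (N : ℝ) - 2 ≤ |(j : ℝ)| := by exact_mod_cast hj
    have h4 : (4 : ℝ) ≤ N := by exact_mod_cast hN4
    have hNn : (N : ℝ) = (n : ℝ) ^ 2 := by rw [hN]; push_cast; rfl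
    have h5 : (N : ℝ) / 2 ≤ |(j : ℝ)| := by linarith
    have h6 : (N : ℝ) ^ 2 / 4 ≤ (j : ℝ) ^ 2 := by
      rw [← sq_abs (j : ℝ)]; nlinarith
    rw [div_le_div_iff₀ (by positivity) (by positivity), div_pow]
    have h7 : (n : ℝ) ^ 2 / 4 ≤ (j : ℝ) ^ 2 / n ^ 2 := by
      rw [le_div_iff₀ (by positivity), ← hNn]; linarith
    nlinarith
  have b1 : ‖a (N - 1)‖ ≤ 4 * C / n ^ 2 := hedge _ (by rw [le_abs]; left; omega)
  have b2 : ‖a (-N - 1)‖ ≤ 4 * C / n ^ 2 := hedge _ (by rw [le_abs]; right; omega)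
  have b3 : ‖a (N - 1 - 1)‖ ≤ 4 * C / n ^ 2 := hedge _ (by rw [le_abs]; left; omega)
  have b4 : ‖a (-N - 1 - 1)‖ ≤ 4 * C / n ^ 2 := hedge _ (by rw [le_abs]; right; omega)
  have s1 := norm_sub_one_mul_norm_sum_zpow_le a hz1 N
  have s2 := norm_sub_one_mul_norm_sum_zpow_le (fun j => a (j - 1) - a j) hz1 N
  have hsecond : ‖∑ j ∈ Finset.Ico (-(N : ℤ)) (N : ℤ),
      (a (j - 1 - 1) - a (j - 1) - (a (j - 1) - a j)) * z ^ j‖ ≤ 4 * K / n := by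
    calc _ ≤ ∑ j ∈ Finset.Ico (-(N : ℤ)) (N : ℤ),
          K * (1 / (n : ℝ)) ^ 2 * (1 / (1 + ((j : ℝ) / n) ^ 2)) := by
          refine norm_sum_le_of_le _ fun j _ => ?_
          rw [norm_mul, norm_zpow, hz1, one_zpow, mul_one, mul_one_div]
          have e1 : a (j - 1) = g ((j : ℝ) / n - 1 / n) := by
            simp only [ha, Int.cast_sub, Int.cast_one, sub_div]
          have e2 : a (j - 1 - 1) = g ((j : ℝ) / n - 1 / n - 1 / n) := by
            simp only [ha, Int.cast_sub, Int.cast_one, sub_div]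
          rw [e1, e2]
          exact hK ((j : ℝ) / n) (1 / n) (by positivity) ((div_le_one hn').2 hn1)
      _ ≤ K * (1 / (n : ℝ)) ^ 2 * (4 * n) := by
          rw [← Finset.mul_sum]; gcongr
      _ = _ := by field_simp
  set S := ∑ j ∈ Finset.Ico (-(N : ℤ)) (N : ℤ), a j * z ^ j with hS
  set S₁ := ∑ j ∈ Finset.Ico (-(N : ℤ)) (N : ℤ), (a (j - 1) - a j) * z ^ j with hS₁
  have hz2 : ‖z - 1‖ ≤ 2 := (norm_sub_le _ _).trans (by rw [hz1, norm_one]; norm_num)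
  have hkey : ‖z - 1‖ ^ 2 * ‖S‖ ≤ (32 * C + 4 * K) / n := by
    have t1 := norm_sub_le (a (N - 1 - 1)) (a (N - 1))
    have t2 := norm_sub_le (a (-N - 1 - 1)) (a (-N - 1))
    have t3 : ‖z - 1‖ * ‖S₁‖ ≤ 4 * K / n + 4 * (4 * C / n ^ 2) := by linarith
    have t4 : ‖z - 1‖ * (‖z - 1‖ * ‖S‖) ≤ ‖z - 1‖ * ‖S₁‖ + 2 * (2 * (4 * C / n ^ 2)) := by
      calc _ ≤ ‖z - 1‖ * (‖S₁‖ + (‖a (N - 1)‖ + ‖a (-N - 1)‖)) := by gcongr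
        _ ≤ _ := by
          rw [mul_add]
          gcongr
          linarith
    have t5 : 4 * C / (n : ℝ) ^ 2 ≤ 4 * C / n := by
      gcongr
      nlinarith
    calc ‖z - 1‖ ^ 2 * ‖S‖ = ‖z - 1‖ * (‖z - 1‖ * ‖S‖) := by ring
      _ ≤ 4 * K / n + 8 * (4 * C / n) := by linarith
      _ = _ := by ring
  have hlow := le_norm_exp_sub_one hn hk
  rw [← hz] at hlow
  have hG : ‖gridFourier g n ((k : ℝ) / n)‖ = ‖S‖ / n := by
    rw [gridFourier_eq _ hn, norm_smul, Real.norm_of_nonneg (by positivity)]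
    ring
  have hSle : ‖S‖ ≤ C * (4 * n) := by
    calc ‖S‖ ≤ ∑ j ∈ Finset.Ico (-(N : ℤ)) (N : ℤ), C * (1 / (1 + ((j : ℝ) / n) ^ 2)) := by
          refine norm_sum_le_of_le _ fun j _ => ?_
          rw [norm_mul, norm_zpow, hz1, one_zpow, mul_one, mul_one_div]
          exact hC _
      _ ≤ _ := by rw [← Finset.mul_sum]; gcongr
  rw [hG, le_div_iff₀ (by positivity), mul_add, mul_one]
  refine add_le_add ?_ ?_
  · rw [div_le_iff₀ hn']; linarith
  · have h1 : (2 * |(k : ℝ)| / n ^ 2) ^ 2 * ‖S‖ ≤ (32 * C + 4 * K) / n :=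
      le_trans (by gcongr) hkey
    have h2 : (2 * |(k : ℝ)| / n ^ 2) ^ 2 * ‖S‖ = 4 * (‖S‖ / n * ((k : ℝ) / n) ^ 2) / n := by
      rw [div_pow, mul_pow, sq_abs]
      field_simp
      ring
    rw [h2, div_le_div_iff_of_pos_right hn'] at h1
    linarith

/-- The uniform decay supplies the integrable majorant that pointwise convergence of the transforms
lacks. -/
theorem tendsto_gridSum_gridFourier (g : 𝓢(ℝ, ℂ)) :
    Tendsto (fun n : ℕ => gridSum n (Finset.Ico (-((n ^ 2 : ℕ) : ℤ)) ((n ^ 2 : ℕ) : ℤ))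
      (gridFourier g n)) atTop (nhds (∫ t, fourier g t)) := by
  obtain ⟨C, -, hC⟩ := exists_norm_gridFourier_le g
  have hlim : ∀ x, Tendsto (fun n : ℕ => gridFourier g n (gridFloor n x)) atTop
      (nhds (fourier g x)) := by
    intro x
    have h : Tendsto (fun n : ℕ => (n, gridFloor n x)) atTop (atTop ×ˢ nhds x) :=
      tendsto_id.prodMk (tendsto_gridFloor tendsto_id tendsto_const_nhds)
    have := (tendsto_gridFourier g x).comp h
    simpa only [Function.comp_def] using this
  exact tendsto_gridSum (n := fun n : ℕ => n) (h := fun n => gridFourier g n) tendsto_id hC hlim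

-- Germs, standard parts and limits along the ultrafilter.

universe u

variable {ι : Type u} {U : Ultrafilter ι}

theorem isStdPart_coe_iff {E : Type*} [NormedAddCommGroup E] {v : ι → E} {w : E} :
    IsStdPart (v : Germ (U : Filter ι) E) w ↔ Tendsto v U (nhds w) := by
  rw [Metric.tendsto_nhds]
  simp only [dist_eq_norm]
  exact forall₂_congr fun ε _ => Germ.coe_lt

theorem isInfinite_coe_iff {n : ι → ℕ} :
    IsInfinite (n : Germ (U : Filter ι) ℕ) ↔ Tendsto n U atTop := by
  constructor
  · intro h
    exact tendsto_atTop.2 fun k => (Germ.coe_lt.1 (h k)).mono fun i hi => le_of_lt hi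
  · exact fun h k => Germ.coe_lt.2 (h.eventually_gt_atTop k)

/-- The extended standard part is the limit along the ultrafilter. -/
theorem tendsto_st (v : ι → ℝ) :
    Tendsto (fun i => (v i : EReal)) U (nhds (st (v : Germ (U : Filter ι) ℝ))) := by
  refine tendsto_order.2 ⟨fun a ha => ?_, fun b hb => ?_⟩
  · obtain ⟨r, ha⟩ := lt_iSup_iff.1 ha
    obtain ⟨hr, ha⟩ := lt_iSup_iff.1 ha
    have hr' : ∀ᶠ i in (U : Filter ι), r ≤ v i := hr
    exact hr'.mono fun i hi => ha.trans_le (EReal.coe_le_coe_iff.2 hi)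
  · obtain ⟨r, hr, hb⟩ := EReal.lt_iff_exists_real_btwn.1 hb
    have h : ¬ ∀ᶠ i in (U : Filter ι), r ≤ v i := fun h =>
      absurd hr (not_lt.2 (le_iSup₂_of_le
        (f := fun (r : ℝ) (_ : (r : Germ (U : Filter ι) ℝ) ≤ v) => (r : EReal)) r h le_rfl))
    refine (Ultrafilter.eventually_not.2 h).mono fun i hi => ?_
    exact lt_trans (EReal.coe_lt_coe_iff.2 (not_le.1 hi)) hb

theorem tendsto_ofReal_st (v : ι → ℝ) :
    Tendsto (fun i => ENNReal.ofReal (v i)) U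
      (nhds (st (v : Germ (U : Filter ι) ℝ)).toENNReal) := by
  have h := (EReal.continuous_toENNReal.tendsto _).comp (tendsto_st (U := U) v)
  refine h.congr fun i => ?_
  simp [Function.comp, EReal.toENNReal_of_ne_top]

theorem eventually_pos {n : ι → ℕ} (hn : Tendsto n U atTop) : ∀ᶠ i in (U : Filter ι), 0 < n i :=
  hn.eventually_gt_atTop 0

theorem le_interval_coe_iff {N : ι → ℕ} {A : ι → Finset ℤ} :
    (A : Germ (U : Filter ι) (Finset ℤ)) ≤ interval (N : Germ (U : Filter ι) ℕ) ↔
      ∀ᶠ i in (U : Filter ι), A i ⊆ Finset.Ico (-(N i : ℤ)) (N i : ℤ) :=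
  Iff.rfl

theorem inCell_coe_iff {n : ι → ℕ} (hn : Tendsto n U atTop) {j : ι → ℤ} {ξ : ι → ℝ} :
    InCell (n : Germ (U : Filter ι) ℕ) j ξ ↔ ∀ᶠ i in (U : Filter ι), ⌊(n i : ℝ) * ξ i⌋ = j i := by
  have h1 : InCell (n : Germ (U : Filter ι) ℕ) j ξ ↔
      (∀ᶠ i in (U : Filter ι), (j i : ℝ) / n i ≤ ξ i) ∧
        ∀ᶠ i in (U : Filter ι), ξ i < ((j i : ℝ) + 1) / n i :=
    and_congr Iff.rfl Germ.coe_lt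
  rw [h1, ← eventually_and]
  refine eventually_congr ((eventually_pos hn).mono fun i hi => ?_)
  have hi' : (0 : ℝ) < n i := by positivity
  rw [Int.floor_eq_iff, div_le_iff₀ hi', lt_div_iff₀ hi', mul_comm (n i : ℝ)]

theorem mem_cellUnion_iff {N n : ι → ℕ} (hn : Tendsto n U atTop) {A : ι → Finset ℤ}
    {x : Rbar (N : Germ (U : Filter ι) ℕ) (n : Germ (U : Filter ι) ℕ)} {ξ : ι → ℝ}
    (hx : x.1 = (ξ : Germ (U : Filter ι) ℝ)) :
    x ∈ cellUnion _ _ (A : Germ (U : Filter ι) (Finset ℤ)) ↔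
      ∀ᶠ i in (U : Filter ι), ⌊(n i : ℝ) * ξ i⌋ ∈ A i := by
  constructor
  · rintro ⟨j, hj, hc⟩
    induction j using Germ.inductionOn with | _ j => ?_
    rw [hx, inCell_coe_iff hn] at hc
    have hj' : ∀ᶠ i in (U : Filter ι), j i ∈ A i := hj
    filter_upwards [hc, hj'] with i h1 h2
    rwa [h1]
  · intro h
    refine ⟨((fun i => ⌊(n i : ℝ) * ξ i⌋ : ι → ℤ) : Germ (U : Filter ι) ℤ), h, ?_⟩
    rw [hx, inCell_coe_iff hn]
    exact Eventually.of_forall fun _ => rfl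

theorem div_mem_Rbar {N n : ι → ℕ} {j : ι → ℤ}
    (hj : ∀ᶠ i in (U : Filter ι), j i ∈ Finset.Ico (-(N i : ℤ)) (N i : ℤ))
    (hn : Tendsto n U atTop) :
    -(ofNat (N : Germ (U : Filter ι) ℕ) / ofNat (n : Germ (U : Filter ι) ℕ)) ≤
        ((fun i => (j i : ℝ) / n i : ι → ℝ) : Germ (U : Filter ι) ℝ) ∧
      ((fun i => (j i : ℝ) / n i : ι → ℝ) : Germ (U : Filter ι) ℝ) <
        ofNat (N : Germ (U : Filter ι) ℕ) / ofNat (n : Germ (U : Filter ι) ℕ) := by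
  constructor
  · have : ∀ᶠ i in (U : Filter ι), -((N i : ℝ) / n i) ≤ (j i : ℝ) / n i := by
      filter_upwards [hj, eventually_pos hn] with i hi h0
      rw [← neg_div]
      gcongr
      exact_mod_cast (Finset.mem_Ico.1 hi).1
    exact this
  · refine Germ.coe_lt.2 ?_
    filter_upwards [hj, eventually_pos hn] with i hi h0
    have h0' : (0 : ℝ) < n i := by positivity
    change (j i : ℝ) / n i < (N i : ℝ) / n i
    gcongr
    exact_mod_cast (Finset.mem_Ico.1 hi).2

theorem floor_mul_div {n : ℕ} (hn : 0 < n) (j : ℤ) : ⌊(n : ℝ) * ((j : ℝ) / n)⌋ = j := by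
  have : (n : ℝ) ≠ 0 := by positivity
  rw [mul_div_cancel₀ _ this, Int.floor_intCast]

/-! ### Saturation and the Loeb measure of internal sets. -/

/-- Countable saturation: a countable cover of an internal set by internal sets has a finite
subcover. -/
theorem exists_finite_subcover {N n : ι → ℕ} (hn : Tendsto n U atTop) {A : ι → Finset ℤ}
    (hA : ∀ᶠ i in (U : Filter ι), A i ⊆ Finset.Ico (-(N i : ℤ)) (N i : ℤ))
    {B : ℕ → ι → Finset ℤ}
    (hcover : cellUnion (N : Germ (U : Filter ι) ℕ) n (A : Germ (U : Filter ι) (Finset ℤ)) ⊆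
      ⋃ k, cellUnion (N : Germ (U : Filter ι) ℕ) n (B k : Germ (U : Filter ι) (Finset ℤ))) :
    ∃ m, ∀ᶠ i in (U : Filter ι), A i ⊆ (Finset.range m).biUnion fun k => B k i := by
  classical
  by_contra! hcon
  let P : ι → ℕ → Prop := fun i m => ∃ j ∈ A i, ∀ k < m, j ∉ B k i
  have hP : ∀ m, ∀ᶠ i in (U : Filter ι), P i m := by
    intro m
    refine (hcon m).mono fun i hi => ?_
    rw [Finset.not_subset] at hi
    obtain ⟨j, hj, hj'⟩ := hi
    refine ⟨j, hj, fun k hk hjk => hj' ?_⟩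
    exact Finset.mem_biUnion.2 ⟨k, Finset.mem_range.2 hk, hjk⟩
  -- Diagonal choice: at index `i`, avoid as many of the first `n i` sets as possible. Since `n`
  -- tends to infinity, the resulting point avoids every `B k`.
  let M : ι → ℕ := fun i => Nat.findGreatest (P i) (n i)
  have hM : ∀ i, ∃ j : ℤ, P i 0 → j ∈ A i ∧ ∀ k < M i, j ∉ B k i := by
    intro i
    by_cases h0 : P i 0
    · obtain ⟨j, hj⟩ := Nat.findGreatest_spec (P := P i) (Nat.zero_le (n i)) h0
      exact ⟨j, fun _ => hj⟩
    · exact ⟨0, fun h => absurd h h0⟩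
  choose j hj using hM
  have hjA : ∀ᶠ i in (U : Filter ι), j i ∈ A i := (hP 0).mono fun i hi => (hj i hi).1
  have hjN := hjA.mp (hA.mono fun i hi hji => hi hji)
  let x : Rbar (N : Germ (U : Filter ι) ℕ) (n : Germ (U : Filter ι) ℕ) :=
    ⟨_, div_mem_Rbar hjN hn⟩
  have hx : x ∈ cellUnion _ _ (A : Germ (U : Filter ι) (Finset ℤ)) := by
    rw [mem_cellUnion_iff hn rfl]
    filter_upwards [hjA, eventually_pos hn] with i hi h0
    rwa [floor_mul_div h0]
  obtain ⟨k, hk⟩ := Set.mem_iUnion.1 (hcover hx)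
  rw [mem_cellUnion_iff hn rfl] at hk
  obtain ⟨i, h1, h2, h3, h4, h5⟩ := (hk.and ((eventually_pos hn).and ((hP (k + 1)).and ((hP 0).and
    (hn.eventually_ge_atTop (k + 1)))))).exists
  rw [floor_mul_div h2] at h1
  exact (hj i h4).2 k (Nat.le_findGreatest h5 h3) h1

/-- Saturation for a constant cover. It makes an internal set recoverable from its cells, so the
infimum defining `premeasure` runs over a single germ. -/
theorem cellUnion_subset_iff {N n : ι → ℕ} (hn : Tendsto n U atTop) {A B : ι → Finset ℤ}
    (hA : ∀ᶠ i in (U : Filter ι), A i ⊆ Finset.Ico (-(N i : ℤ)) (N i : ℤ))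
    (h : cellUnion (N : Germ (U : Filter ι) ℕ) n (A : Germ (U : Filter ι) (Finset ℤ)) ⊆
      cellUnion (N : Germ (U : Filter ι) ℕ) n (B : Germ (U : Filter ι) (Finset ℤ))) :
    ∀ᶠ i in (U : Filter ι), A i ⊆ B i := by
  obtain ⟨m, hm⟩ := exists_finite_subcover (B := fun _ => B) hn hA
    (h.trans (Set.subset_iUnion_of_subset 0 subset_rfl))
  refine hm.mono fun i hi => hi.trans fun j hj => ?_
  obtain ⟨_, _, hj⟩ := Finset.mem_biUnion.1 hj
  exact hj

theorem premeasure_cellUnion {N n : ι → ℕ} (hn : Tendsto n U atTop) {A : ι → Finset ℤ}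
    (hA : ∀ᶠ i in (U : Filter ι), A i ⊆ Finset.Ico (-(N i : ℤ)) (N i : ℤ)) :
    premeasure (N : Germ (U : Filter ι) ℕ) n
      (cellUnion (N : Germ (U : Filter ι) ℕ) n (A : Germ (U : Filter ι) (Finset ℤ))) =
      (st (counting (n : Germ (U : Filter ι) ℕ) (A : Germ (U : Filter ι) (Finset ℤ)))).toENNReal := by
  refine le_antisymm (iInf₂_le _ ⟨le_interval_coe_iff.2 hA, rfl⟩) (le_iInf₂ ?_)
  rintro B ⟨hB, hAB⟩
  induction B using Germ.inductionOn with | _ B => ?_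
  have h1 := cellUnion_subset_iff hn hA hAB.le
  have h2 := cellUnion_subset_iff hn (le_interval_coe_iff.1 hB) hAB.ge
  have : (A : Germ (U : Filter ι) (Finset ℤ)) = B := Germ.coe_eq.2 (by
    filter_upwards [h1, h2] with i h1 h2 using Finset.Subset.antisymm h1 h2)
  rw [this]

theorem tendsto_card_div (n : ι → ℕ) (A : ι → Finset ℤ) :
    Tendsto (fun i => ENNReal.ofReal (((A i).card : ℝ) / n i)) U (nhds (st (counting
      (n : Germ (U : Filter ι) ℕ) (A : Germ (U : Filter ι) (Finset ℤ)))).toENNReal) :=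
  tendsto_ofReal_st _

theorem st_counting_le_sum {n : ι → ℕ} {A : ι → Finset ℤ} {B : ℕ → ι → Finset ℤ} {m : ℕ}
    (h : ∀ᶠ i in (U : Filter ι), A i ⊆ (Finset.range m).biUnion fun k => B k i) :
    (st (counting (n : Germ (U : Filter ι) ℕ) (A : Germ (U : Filter ι) (Finset ℤ)))).toENNReal ≤
      ∑ k ∈ Finset.range m, (st (counting (n : Germ (U : Filter ι) ℕ)
        (B k : Germ (U : Filter ι) (Finset ℤ)))).toENNReal := by
  refine le_of_tendsto_of_tendsto (tendsto_card_div n A)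
    (tendsto_finsetSum _ fun k _ => tendsto_card_div n (B k)) ?_
  filter_upwards [h] with i hi
  rw [← ENNReal.ofReal_sum_of_nonneg fun k _ => by positivity, ← Finset.sum_div]
  gcongr
  exact_mod_cast (Finset.card_le_card hi).trans Finset.card_biUnion_le

/-- Countable covers cannot undercut the premeasure: a cover by sets of the algebra has a finite
subcover, and finite subadditivity passes to the limit. A cover using any other set has infinite
cost. -/
theorem outer_cellUnion {N n : ι → ℕ} (hn : Tendsto n U atTop) {A : ι → Finset ℤ}
    (hA : ∀ᶠ i in (U : Filter ι), A i ⊆ Finset.Ico (-(N i : ℤ)) (N i : ℤ)) :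
    outer (N : Germ (U : Filter ι) ℕ) n
      (cellUnion (N : Germ (U : Filter ι) ℕ) n (A : Germ (U : Filter ι) (Finset ℤ))) =
      (st (counting (n : Germ (U : Filter ι) ℕ) (A : Germ (U : Filter ι) (Finset ℤ)))).toENNReal := by
  refine le_antisymm ((OuterMeasure.ofFunction_le _).trans (premeasure_cellUnion hn hA).le) ?_
  rw [outer, OuterMeasure.ofFunction_apply]
  refine le_iInf₂ fun t ht => ?_
  by_cases hfin : ∀ k, ∃ B : ι → Finset ℤ,
      (∀ᶠ i in (U : Filter ι), B i ⊆ Finset.Ico (-(N i : ℤ)) (N i : ℤ)) ∧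
        t k = cellUnion (N : Germ (U : Filter ι) ℕ) n (B : Germ (U : Filter ι) (Finset ℤ))
  · choose B hB htB using hfin
    obtain rfl : t = fun k => cellUnion (N : Germ (U : Filter ι) ℕ) n
        (B k : Germ (U : Filter ι) (Finset ℤ)) := funext htB
    obtain ⟨m, hm⟩ := exists_finite_subcover hn hA ht
    simp only [premeasure_cellUnion hn (hB _)]
    exact (st_counting_le_sum hm).trans (ENNReal.sum_le_tsum _)
  · push Not at hfin
    obtain ⟨k, hk⟩ := hfin
    have : premeasure (N : Germ (U : Filter ι) ℕ) n (t k) = ⊤ := by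
      refine iInf₂_eq_top.2 ?_
      rintro B ⟨hB, hAB⟩
      induction B using Germ.inductionOn with | _ B => ?_
      exact absurd hAB (hk B (le_interval_coe_iff.1 hB))
    rw [ENNReal.tsum_eq_top_of_eq_top ⟨k, this⟩]
    exact le_top

theorem measurableSet_generateFrom_cellUnion {N n : ι → ℕ} {A : ι → Finset ℤ}
    (hA : ∀ᶠ i in (U : Filter ι), A i ⊆ Finset.Ico (-(N i : ℤ)) (N i : ℤ)) :
    MeasurableSet[MeasurableSpace.generateFrom
      (cellAlgebra (N : Germ (U : Filter ι) ℕ) (n : Germ (U : Filter ι) ℕ))]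
      (cellUnion (N : Germ (U : Filter ι) ℕ) n (A : Germ (U : Filter ι) (Finset ℤ))) :=
  MeasurableSpace.measurableSet_generateFrom ⟨_, le_interval_coe_iff.2 hA, rfl⟩

theorem measurableSet_cellUnion {N n : ι → ℕ} {A : ι → Finset ℤ}
    (hA : ∀ᶠ i in (U : Filter ι), A i ⊆ Finset.Ico (-(N i : ℤ)) (N i : ℤ)) :
    MeasurableSet
      (cellUnion (N : Germ (U : Filter ι) ℕ) n (A : Germ (U : Filter ι) (Finset ℤ))) :=
  @MeasurableSet.nullMeasurableSet _ (MeasurableSpace.generateFrom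
      (cellAlgebra (N : Germ (U : Filter ι) ℕ) (n : Germ (U : Filter ι) ℕ)))
    (sigmaMeasure _ _) _ (measurableSet_generateFrom_cellUnion hA)

theorem loebMeasure_cellUnion {N n : ι → ℕ} (hn : Tendsto n U atTop) {A : ι → Finset ℤ}
    (hA : ∀ᶠ i in (U : Filter ι), A i ⊆ Finset.Ico (-(N i : ℤ)) (N i : ℤ)) :
    loebMeasure (N : Germ (U : Filter ι) ℕ) n
      (cellUnion (N : Germ (U : Filter ι) ℕ) n (A : Germ (U : Filter ι) (Finset ℤ))) =
      (st (counting (n : Germ (U : Filter ι) ℕ) (A : Germ (U : Filter ι) (Finset ℤ)))).toENNReal := by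
  rw [← outer_cellUnion hn hA]
  exact @toMeasure_apply _ (MeasurableSpace.generateFrom
      (cellAlgebra (N : Germ (U : Filter ι) ℕ) (n : Germ (U : Filter ι) ℕ))) _
      (generateFrom_le _ _) _ (measurableSet_generateFrom_cellUnion hA)

theorem exists_coe_eq {N n : ι → ℕ} (hn : Tendsto n U atTop)
    (x : Rbar (N : Germ (U : Filter ι) ℕ) (n : Germ (U : Filter ι) ℕ)) :
    ∃ ξ : ι → ℝ, x.1 = (ξ : Germ (U : Filter ι) ℝ) ∧
      ∀ᶠ i in (U : Filter ι), ⌊(n i : ℝ) * ξ i⌋ ∈ Finset.Ico (-(N i : ℤ)) (N i : ℤ) := by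
  obtain ⟨x, hx⟩ := x
  induction x using Germ.inductionOn with | _ ξ => ?_
  refine ⟨ξ, rfl, ?_⟩
  have h1 : ∀ᶠ i in (U : Filter ι), -((N i : ℝ) / n i) ≤ ξ i := hx.1
  have h2 : ∀ᶠ i in (U : Filter ι), ξ i < (N i : ℝ) / n i := Germ.coe_lt.1 hx.2
  filter_upwards [h1, h2, eventually_pos hn] with i h1 h2 h0
  have h0' : (0 : ℝ) < n i := by positivity
  rw [← neg_div, div_le_iff₀ h0'] at h1
  rw [lt_div_iff₀ h0'] at h2
  rw [Finset.mem_Ico, Int.le_floor, Int.floor_lt]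
  push_cast
  constructor <;> linarith

/-! ### The standard part map and Lebesgue measure. -/

/-- The asymptotic counting measure of the points of the grid between `a` and `b`. -/
theorem tendsto_card_Ico_floor_div {n : ι → ℕ} (hn : Tendsto n U atTop) {a b : ℝ} (hab : a ≤ b) :
    Tendsto (fun i => ((Finset.Ico ⌊(n i : ℝ) * a⌋ ⌊(n i : ℝ) * b⌋).card : ℝ) / n i) U
      (nhds (b - a)) := by
  have h := (tendsto_gridFloor hn (tendsto_const_nhds (x := b))).sub
    (tendsto_gridFloor hn (tendsto_const_nhds (x := a)))
  refine h.congr fun i => ?_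
  have hle : ⌊(n i : ℝ) * a⌋ ≤ ⌊(n i : ℝ) * b⌋ := Int.floor_mono (by gcongr)
  rw [gridFloor, gridFloor, ← sub_div, Int.card_Ico]
  congr 1
  have : (((⌊(n i : ℝ) * b⌋ - ⌊(n i : ℝ) * a⌋).toNat : ℤ) : ℝ) =
      ((⌊(n i : ℝ) * b⌋ - ⌊(n i : ℝ) * a⌋ : ℤ) : ℝ) := by
    rw [Int.toNat_of_nonneg (sub_nonneg.2 hle)]
  rw [Int.cast_natCast] at this
  rw [this, Int.cast_sub]

theorem eventually_Ico_floor_subset {n : ι → ℕ} (hn : Tendsto n U atTop) (a b : ℝ) :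
    ∀ᶠ i in (U : Filter ι), Finset.Ico ⌊(n i : ℝ) * a⌋ ⌊(n i : ℝ) * b⌋ ⊆
      Finset.Ico (-(((n ^ 2) i : ℕ) : ℤ)) (((n ^ 2) i : ℕ) : ℤ) := by
  filter_upwards [hn.eventually_ge_atTop ⌈|a|⌉₊, hn.eventually_ge_atTop ⌈|b|⌉₊] with i ha hb
  have ha' := abs_le.1 (Nat.ceil_le.1 ha)
  have hb' := abs_le.1 (Nat.ceil_le.1 hb)
  have h0 : (0 : ℝ) ≤ n i := by positivity
  refine Finset.Ico_subset_Ico ?_ ?_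
  · rw [Int.le_floor, Pi.pow_apply]
    push_cast
    nlinarith [ha'.1]
  · have : (⌊(n i : ℝ) * b⌋ : ℝ) ≤ (((n ^ 2) i : ℕ) : ℤ) := by
      refine (Int.floor_le _).trans ?_
      rw [Pi.pow_apply]
      push_cast
      nlinarith [hb'.2]
    exact_mod_cast this

theorem loebMeasure_cellUnion_Ico {n : ι → ℕ} (hn : Tendsto n U atTop) {a b : ℝ} (hab : a ≤ b) :
    loebMeasure ((n ^ 2 : ι → ℕ) : Germ (U : Filter ι) ℕ) n (cellUnion ((n ^ 2 : ι → ℕ) : Germ (U : Filter ι) ℕ) n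
      ((fun i => Finset.Ico ⌊(n i : ℝ) * a⌋ ⌊(n i : ℝ) * b⌋ : ι → Finset ℤ) :
        Germ (U : Filter ι) (Finset ℤ))) = ENNReal.ofReal (b - a) :=
  (loebMeasure_cellUnion (N := n ^ 2) hn (eventually_Ico_floor_subset hn a b)).trans
    (tendsto_nhds_unique (tendsto_card_div _ _)
      ((ENNReal.continuous_ofReal.tendsto _).comp (tendsto_card_Ico_floor_div hn hab)))

/-- Cell indices and standard parts determine each other only up to endpoints: index comparisons
give weak inequalities of standard parts, and the converses need strict ones. -/
theorem le_st_of_floor_le {n : ι → ℕ} (hn : Tendsto n U atTop) {a : ℝ} {ξ : ι → ℝ}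
    (h : ∀ᶠ i in (U : Filter ι), ⌊(n i : ℝ) * a⌋ ≤ ⌊(n i : ℝ) * ξ i⌋) :
    (a : EReal) ≤ st (ξ : Germ (U : Filter ι) ℝ) := by
  have h1 : Tendsto (fun i => (gridFloor (n i) a : EReal)) U (nhds (a : EReal)) :=
    (continuous_coe_real_ereal.tendsto a).comp (tendsto_gridFloor hn tendsto_const_nhds)
  refine le_of_tendsto_of_tendsto h1 (tendsto_st ξ) ?_
  filter_upwards [h, eventually_pos hn] with i hi h0
  refine EReal.coe_le_coe_iff.2 (le_trans ?_ (gridFloor_le h0 (ξ i)))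
  rw [gridFloor, gridFloor]
  gcongr

theorem eventually_floor_le_of_lt_st {n : ι → ℕ} {a : ℝ} {ξ : ι → ℝ}
    (h : (a : EReal) < st (ξ : Germ (U : Filter ι) ℝ)) :
    ∀ᶠ i in (U : Filter ι), ⌊(n i : ℝ) * a⌋ ≤ ⌊(n i : ℝ) * ξ i⌋ := by
  filter_upwards [(tendsto_st ξ).eventually_const_lt h] with i hi
  have hi := EReal.coe_lt_coe_iff.1 hi
  exact Int.floor_mono (by gcongr)

theorem st_le_of_floor_lt {n : ι → ℕ} {b : ℝ} {ξ : ι → ℝ}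
    (h : ∀ᶠ i in (U : Filter ι), ⌊(n i : ℝ) * ξ i⌋ < ⌊(n i : ℝ) * b⌋) :
    st (ξ : Germ (U : Filter ι) ℝ) ≤ b := by
  refine le_of_tendsto (tendsto_st ξ) ?_
  filter_upwards [h] with i hi
  refine EReal.coe_le_coe_iff.2 ?_
  by_contra! hlt
  exact absurd hi (not_lt.2 (Int.floor_mono (by gcongr)))

theorem eventually_floor_lt_of_st_lt {n : ι → ℕ} (hn : Tendsto n U atTop) {b : ℝ} {ξ : ι → ℝ}
    (h : st (ξ : Germ (U : Filter ι) ℝ) < b) :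
    ∀ᶠ i in (U : Filter ι), ⌊(n i : ℝ) * ξ i⌋ < ⌊(n i : ℝ) * b⌋ := by
  obtain ⟨r, hr, hrb⟩ := EReal.lt_iff_exists_real_btwn.1 h
  have h1 := (tendsto_gridFloor hn (tendsto_const_nhds (x := b))).eventually_const_lt
    (EReal.coe_lt_coe_iff.1 hrb)
  filter_upwards [(tendsto_st ξ).eventually_lt_const hr, h1, eventually_pos hn] with i h2 h3 h0
  have h0' : (0 : ℝ) < n i := by positivity
  have h4 := (gridFloor_le h0 (ξ i)).trans_lt ((EReal.coe_lt_coe_iff.1 h2).trans h3)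
  rw [gridFloor, gridFloor, div_lt_div_iff_of_pos_right h0'] at h4
  exact_mod_cast h4

/-- The set where the standard part exceeds `y` is a countable union, over rationals `q > y`, of the
internal sets of cells from `q` rightwards. -/
theorem measurable_st {n : ι → ℕ} (hn : Tendsto n U atTop) :
    Measurable fun x : Rbar ((n ^ 2 : ι → ℕ) : Germ (U : Filter ι) ℕ) n => st x.1 := by
  let D : ℚ → ι → Finset ℤ := fun q i =>
    (Finset.Ico (-(((n ^ 2) i : ℕ) : ℤ)) (((n ^ 2) i : ℕ) : ℤ)).filter (⌊(n i : ℝ) * q⌋ ≤ ·)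
  refine measurable_of_Ioi fun y => ?_
  have heq : (fun x : Rbar ((n ^ 2 : ι → ℕ) : Germ (U : Filter ι) ℕ) n => st x.1) ⁻¹' Set.Ioi y =
      ⋃ (q : ℚ) (_ : y < ((q : ℝ) : EReal)), cellUnion ((n ^ 2 : ι → ℕ) : Germ (U : Filter ι) ℕ) n
        (D q : Germ (U : Filter ι) (Finset ℤ)) := by
    ext x
    obtain ⟨ξ, hx, hfloor⟩ := exists_coe_eq hn x
    simp only [Set.mem_preimage, Set.mem_Ioi, Set.mem_iUnion, exists_prop, hx]
    constructor
    · intro h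
      obtain ⟨q, hq, hqx⟩ := EReal.exists_rat_btwn_of_lt h
      refine ⟨q, hq, (mem_cellUnion_iff (N := n ^ 2) hn hx).2 ?_⟩
      filter_upwards [hfloor, eventually_floor_le_of_lt_st (n := n) hqx] with i h1 h2
      exact Finset.mem_filter.2 ⟨h1, h2⟩
    · rintro ⟨q, hq, h⟩
      refine hq.trans_le (le_st_of_floor_le hn ?_)
      exact ((mem_cellUnion_iff (N := n ^ 2) hn hx).1 h).mono fun i hi => (Finset.mem_filter.1 hi).2
  rw [heq]
  refine MeasurableSet.iUnion fun q => MeasurableSet.iUnion fun _ => ?_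
  exact measurableSet_cellUnion (N := n ^ 2) (Eventually.of_forall fun i => Finset.filter_subset _ _)

/-- The set is squeezed between the cells of `[a + δ, b - δ)` and those of `[a, b)`; then `δ` tends
to 0. -/
theorem loebMeasure_st_preimage_Ioo {n : ι → ℕ} (hn : Tendsto n U atTop) (a b : ℝ) :
    loebMeasure ((n ^ 2 : ι → ℕ) : Germ (U : Filter ι) ℕ) n
      {x | (a : EReal) < st x.1 ∧ st x.1 < b} = ENNReal.ofReal (b - a) := by
  rcases le_or_gt b a with hba | hab
  · rw [ENNReal.ofReal_of_nonpos (by linarith)]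
    convert measure_empty (μ := loebMeasure ((n ^ 2 : ι → ℕ) : Germ (U : Filter ι) ℕ) n)
    refine Set.eq_empty_of_forall_notMem fun x hx => ?_
    exact absurd (EReal.coe_lt_coe_iff.1 (hx.1.trans hx.2)) (not_lt.2 hba)
  apply le_antisymm
  · rw [← loebMeasure_cellUnion_Ico hn hab.le]
    refine measure_mono ?_
    rintro x ⟨h1, h2⟩
    obtain ⟨ξ, hx, -⟩ := exists_coe_eq hn x
    rw [hx] at h1 h2
    refine (mem_cellUnion_iff (N := n ^ 2) hn hx).2 ?_
    filter_upwards [eventually_floor_le_of_lt_st (n := n) h1, eventually_floor_lt_of_st_lt hn h2]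
      with i h1 h2
    exact Finset.mem_Ico.2 ⟨h1, h2⟩
  · have key : ∀ᶠ δ : ℝ in nhdsWithin 0 (Set.Ioi 0), ENNReal.ofReal ((b - δ) - (a + δ)) ≤
        loebMeasure ((n ^ 2 : ι → ℕ) : Germ (U : Filter ι) ℕ) n
          {x | (a : EReal) < st x.1 ∧ st x.1 < b} := by
      filter_upwards [Ioo_mem_nhdsGT (show (0 : ℝ) < (b - a) / 2 by linarith)] with δ hδ
      rw [← loebMeasure_cellUnion_Ico hn (by linarith [hδ.2] : a + δ ≤ b - δ)]
      refine measure_mono ?_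
      intro x h
      obtain ⟨ξ, hx, -⟩ := exists_coe_eq hn x
      have h := (mem_cellUnion_iff (N := n ^ 2) hn hx).1 h
      rw [Set.mem_ofPred_eq, hx]
      constructor
      · refine lt_of_lt_of_le (EReal.coe_lt_coe_iff.2 (by linarith [hδ.1] : a < a + δ)) ?_
        exact le_st_of_floor_le hn (h.mono fun i hi => (Finset.mem_Ico.1 hi).1)
      · refine lt_of_le_of_lt ?_ (EReal.coe_lt_coe_iff.2 (by linarith [hδ.1] : b - δ < b))
        exact st_le_of_floor_lt (h.mono fun i hi => (Finset.mem_Ico.1 hi).2)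
    have hlim : Tendsto (fun δ : ℝ => ENNReal.ofReal ((b - δ) - (a + δ)))
        (nhdsWithin 0 (Set.Ioi 0)) (nhds (ENNReal.ofReal (b - a))) := by
      have hc : Continuous fun δ : ℝ => ENNReal.ofReal ((b - δ) - (a + δ)) :=
        ENNReal.continuous_ofReal.comp (by fun_prop)
      have := hc.tendsto 0
      simp only [sub_zero, add_zero] at this
      exact this.mono_left nhdsWithin_le_nhds
    exact le_of_tendsto hlim key

/-- The set of finite points. -/
def finitePoints (ω η : Germ (U : Filter ι) ℕ) : Set (Rbar ω η) :=
  {x | ¬ (st x.1 = ⊤ ∨ st x.1 = ⊥)}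

theorem measurableSet_finitePoints {n : ι → ℕ} (hn : Tendsto n U atTop) :
    MeasurableSet (finitePoints ((n ^ 2 : ι → ℕ) : Germ (U : Filter ι) ℕ) n) :=
  (((measurableSet_singleton (⊤ : EReal)).preimage (measurable_st hn)).union
    ((measurableSet_singleton (⊥ : EReal)).preimage (measurable_st hn))).compl

theorem measurable_toReal_st {n : ι → ℕ} (hn : Tendsto n U atTop) :
    Measurable fun x : Rbar ((n ^ 2 : ι → ℕ) : Germ (U : Filter ι) ℕ) n => (st x.1).toReal :=
  measurable_ereal_toReal.comp (measurable_st hn)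

/-- The standard part map pushes the Loeb measure on the finite points to Lebesgue measure. -/
theorem map_toReal_st {n : ι → ℕ} (hn : Tendsto n U atTop) :
    ((loebMeasure ((n ^ 2 : ι → ℕ) : Germ (U : Filter ι) ℕ) n).restrict (finitePoints _ _)).map
      (fun x => (st x.1).toReal) = volume := by
  refine (Real.measure_ext_Ioo_rat fun a b => ?_).symm
  rw [Measure.map_apply (measurable_toReal_st hn) measurableSet_Ioo,
    Measure.restrict_apply (measurable_toReal_st hn measurableSet_Ioo), Real.volume_Ioo,
    ← loebMeasure_st_preimage_Ioo hn]
  congr 1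
  ext x
  simp only [Set.mem_inter_iff, Set.mem_preimage, Set.mem_Ioo, finitePoints, Set.mem_ofPred_eq]
  -- `toReal` sends both infinities to 0, so the restriction to finite points is what excludes them.
  induction st x.1 with
  | bot => simp
  | top => simp
  | coe r => simp

theorem extendZero_st_eq_indicator (h : ℝ → ℂ) (ω η : Germ (U : Filter ι) ℕ) :
    (fun x : Rbar ω η => extendZero h (st x.1)) =
      (finitePoints ω η).indicator fun x => h (st x.1).toReal := by
  classical
  funext x
  by_cases hx : st x.1 = ⊤ ∨ st x.1 = ⊥
  · rw [Set.indicator_of_notMem (not_not.2 hx), extendZero, if_pos hx]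
  · rw [Set.indicator_of_mem (show x ∈ finitePoints ω η from hx), extendZero, if_neg hx]

theorem integrable_extendZero_st {n : ι → ℕ} (hn : Tendsto n U atTop) {h : ℝ → ℂ}
    (hh : Integrable h) :
    Integrable (fun x : Rbar ((n ^ 2 : ι → ℕ) : Germ (U : Filter ι) ℕ) n => extendZero h (st x.1))
      (loebMeasure ((n ^ 2 : ι → ℕ) : Germ (U : Filter ι) ℕ) n) := by
  rw [extendZero_st_eq_indicator, integrable_indicator_iff (measurableSet_finitePoints hn)]
  rw [← map_toReal_st hn] at hh
  exact hh.comp_measurable (measurable_toReal_st hn)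

theorem integral_extendZero_st {n : ι → ℕ} (hn : Tendsto n U atTop) {h : ℝ → ℂ}
    (hh : Integrable h) :
    ∫ x : Rbar ((n ^ 2 : ι → ℕ) : Germ (U : Filter ι) ℕ) n, extendZero h (st x.1)
      ∂(loebMeasure ((n ^ 2 : ι → ℕ) : Germ (U : Filter ι) ℕ) n) = ∫ t, h t := by
  rw [extendZero_st_eq_indicator, integral_indicator (measurableSet_finitePoints hn)]
  have hh' := hh.aestronglyMeasurable
  rw [← map_toReal_st hn] at hh' ⊢
  exact (integral_map (measurable_toReal_st hn).aemeasurable hh').symm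

/-! ### S-integrability by domination. -/

theorem gridSum_le_gridSum {n : ℕ} {A B : Finset ℤ} (hAB : A ⊆ B) {f h : ℝ → ℝ}
    (hfh : ∀ j ∈ A, f ((j : ℝ) / n) ≤ h ((j : ℝ) / n)) (hh : ∀ x, 0 ≤ h x) :
    gridSum n A f ≤ gridSum n B h := by
  rw [gridSum, gridSum, smul_eq_mul, smul_eq_mul]
  gcongr ?_ * ?_
  exact (Finset.sum_le_sum hfh).trans
    (Finset.sum_le_sum_of_subset_of_nonneg hAB fun j _ _ => hh _)

theorem gridSum_nonneg {n : ℕ} {A : Finset ℤ} {f : ℝ → ℝ} (hf : ∀ x, 0 ≤ f x) :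
    0 ≤ gridSum n A f :=
  smul_nonneg (by positivity) (Finset.sum_nonneg fun _ _ => hf _)

theorem gridFourier_gridFloor (g : ℝ → ℂ) {n : ℕ} (hn : 0 < n) (t : ℝ) :
    gridFourier g n (gridFloor n t) = gridFourier g n t := by
  have h : gridFloor n (gridFloor n t) = gridFloor n t := gridFloor_div hn _
  have h' : dftIntegrand n (fun x => g (gridFloor n x)) (gridFloor n t) =
      dftIntegrand n (fun x => g (gridFloor n x)) t := by
    funext x
    simp only [dftIntegrand, h]
  rw [gridFourier, gridFourier, h']

theorem internalIntegral_coe {E : Type*} [AddCommGroup E] [Module ℝ E] (n : ι → ℕ)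
    (A : ι → Finset ℤ) (F : ι → ℝ → E) :
    internalIntegral (n : Germ (U : Filter ι) ℕ) (A : Germ (U : Filter ι) (Finset ℤ))
      (F : Germ (U : Filter ι) (ℝ → E)) =
      ((fun i => gridSum (n i) (A i) (F i) : ι → E) : Germ (U : Filter ι) E) := rfl

theorem eval_coe {E : Type*} (F : ι → ℝ → E) (ξ : ι → ℝ) :
    eval (F : Germ (U : Filter ι) (ℝ → E)) (ξ : Germ (U : Filter ι) ℝ) =
      ((fun i => F i (ξ i) : ι → E) : Germ (U : Filter ι) E) := rfl

theorem interval_coe (N : ι → ℕ) : interval (N : Germ (U : Filter ι) ℕ) =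
    ((fun i => Finset.Ico (-(N i : ℤ)) (N i : ℤ) : ι → Finset ℤ) :
      Germ (U : Filter ι) (Finset ℤ)) := rfl

theorem absFun_coe (F : ι → ℝ → ℂ) : absFun (F : Germ (U : Filter ι) (ℝ → ℂ)) =
    ((fun i x => ‖F i x‖ : ι → ℝ → ℝ) : Germ (U : Filter ι) (ℝ → ℝ)) := rfl

theorem dft_discretize_coe (n : ι → ℕ) (g : ℝ → ℂ) :
    dft (n : Germ (U : Filter ι) ℕ) (discretize (n : Germ (U : Filter ι) ℕ) g) =
      ((fun i => gridFourier g (n i) : ι → ℝ → ℂ) : Germ (U : Filter ι) (ℝ → ℂ)) := rfl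

theorem isCellMeasurable_gridFourier {N n : ι → ℕ} (hn : Tendsto n U atTop) (g : ℝ → ℂ) :
    IsCellMeasurable (N : Germ (U : Filter ι) ℕ) n
      ((fun i => gridFourier g (n i) : ι → ℝ → ℂ) : Germ (U : Filter ι) (ℝ → ℂ)) := by
  intro j _ x hx
  induction j using Germ.inductionOn with | _ j => ?_
  induction x using Germ.inductionOn with | _ ξ => ?_
  rw [inCell_coe_iff hn] at hx
  refine Germ.coe_eq.2 ?_
  filter_upwards [hx, eventually_pos hn] with i hi h0
  change gridFourier g (n i) (ξ i) = gridFourier g (n i) ((j i : ℝ) / n i)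
  rw [← gridFourier_gridFloor g h0 (ξ i), gridFloor, hi]

/-- If an internal function is infinitesimal on an internal set, then each standard positive real
bounds it there. -/
theorem eventually_forall_norm_lt {N n : ι → ℕ} (hn : Tendsto n U atTop) {A : ι → Finset ℤ}
    (hA : ∀ᶠ i in (U : Filter ι), A i ⊆ Finset.Ico (-(N i : ℤ)) (N i : ℤ)) {F : ι → ℝ → ℂ}
    (h : ∀ x ∈ cellUnion (N : Germ (U : Filter ι) ℕ) n (A : Germ (U : Filter ι) (Finset ℤ)),
      IsStdPart (eval (F : Germ (U : Filter ι) (ℝ → ℂ)) x.1) 0) {δ : ℝ} (hδ : 0 < δ) :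
    ∀ᶠ i in (U : Filter ι), ∀ j ∈ A i, ‖F i ((j : ℝ) / n i)‖ < δ := by
  by_contra hcon
  have hcon := Ultrafilter.eventually_not.2 hcon
  have hex : ∀ i, ∃ j : ℤ, (¬ ∀ j ∈ A i, ‖F i ((j : ℝ) / n i)‖ < δ) →
      j ∈ A i ∧ δ ≤ ‖F i ((j : ℝ) / n i)‖ := by
    intro i
    by_cases hi : ∀ j ∈ A i, ‖F i ((j : ℝ) / n i)‖ < δ
    · exact ⟨0, fun h => absurd hi h⟩
    · push Not at hi
      obtain ⟨j, hj⟩ := hi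
      exact ⟨j, fun _ => hj⟩
  choose j hj using hex
  have hj' := hcon.mono fun i hi => hj i hi
  have hjN : ∀ᶠ i in (U : Filter ι), j i ∈ Finset.Ico (-(N i : ℤ)) (N i : ℤ) := by
    filter_upwards [hj', hA] with i h1 h2 using h2 h1.1
  -- The violating indices assemble into one point of the internal set, where the function is not
  -- infinitesimal.
  let x : Rbar (N : Germ (U : Filter ι) ℕ) (n : Germ (U : Filter ι) ℕ) :=
    ⟨_, div_mem_Rbar hjN hn⟩
  have hx := h x (by
    rw [mem_cellUnion_iff hn rfl]
    filter_upwards [hj', eventually_pos hn] with i hi h0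
    rw [floor_mul_div h0]
    exact hi.1)
  rw [eval_coe, isStdPart_coe_iff] at hx
  have hx' := hx.norm.eventually_lt_const (by rwa [norm_zero])
  obtain ⟨i, h1, h2⟩ := (hx'.and hj').exists
  exact absurd h1 (not_lt.2 h2.2)

/-- An internal function dominated by `C / (1 + x ^ 2)` on the grid is S-integrable. -/
theorem sIntegrable_of_norm_le {n : ι → ℕ} (hn : Tendsto n U atTop) {F : ι → ℝ → ℂ}
    (hF : IsCellMeasurable ((n ^ 2 : ι → ℕ) : Germ (U : Filter ι) ℕ) n
      (F : Germ (U : Filter ι) (ℝ → ℂ))) {C : ℝ} (hC0 : 0 < C)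
    (hC : ∀ᶠ i in (U : Filter ι), ∀ k ∈ Finset.Ico (-((n i ^ 2 : ℕ) : ℤ)) ((n i ^ 2 : ℕ) : ℤ),
      ‖F i ((k : ℝ) / n i)‖ ≤ C / (1 + ((k : ℝ) / n i) ^ 2)) :
    SIntegrable ((n ^ 2 : ι → ℕ) : Germ (U : Filter ι) ℕ) n
      (F : Germ (U : Filter ι) (ℝ → ℂ)) where
  measurable := hF
  finite := by
    refine ⟨C * 4, ?_⟩
    rw [interval_coe, absFun_coe, internalIntegral_coe]
    refine Germ.coe_le.2 ?_
    filter_upwards [hC, hn.eventually eventually_gridSum_le] with i hi hs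
    calc gridSum (n i) (Finset.Ico (-((n i ^ 2 : ℕ) : ℤ)) ((n i ^ 2 : ℕ) : ℤ)) (fun x => ‖F i x‖)
        ≤ gridSum (n i) (Finset.Ico (-((n i ^ 2 : ℕ) : ℤ)) ((n i ^ 2 : ℕ) : ℤ))
            (fun x => C * (1 / (1 + x ^ 2))) := by
          refine gridSum_le_gridSum subset_rfl (fun j hj => ?_) fun x => by positivity
          rw [mul_one_div]
          exact hi j hj
      _ = C * gridSum (n i) (Finset.Ico (-((n i ^ 2 : ℕ) : ℤ)) ((n i ^ 2 : ℕ) : ℤ))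
            (fun x => 1 / (1 + x ^ 2)) := by
          rw [gridSum, gridSum, ← Finset.mul_sum, smul_eq_mul, smul_eq_mul]
          ring
      _ ≤ C * 4 := by gcongr
  small_of_null := by
    intro A hA hnull
    induction A using Germ.inductionOn with | _ A => ?_
    rw [absFun_coe, internalIntegral_coe, isStdPart_coe_iff]
    have hnull : Tendsto (fun i => ((A i).card : ℝ) / n i) U (nhds 0) :=
      isStdPart_coe_iff.1 hnull
    have hnull := hnull.const_mul C
    rw [mul_zero] at hnull
    refine squeeze_zero' (Eventually.of_forall fun i => gridSum_nonneg fun x => norm_nonneg _) ?_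
      hnull
    filter_upwards [hC, le_interval_coe_iff.1 hA] with i hi hAi
    have : gridSum (n i) (A i) (fun x => ‖F i x‖) ≤ gridSum (n i) (A i) (fun _ => C) := by
      refine gridSum_le_gridSum subset_rfl (fun j hj => (hi j (hAi hj)).trans ?_) fun _ => hC0.le
      exact div_le_self hC0.le (by nlinarith [sq_nonneg ((j : ℝ) / n i)])
    refine this.trans (le_of_eq ?_)
    rw [gridSum, Finset.sum_const, smul_eq_mul, nsmul_eq_mul]
    ring
  small_of_infinitesimal := by
    intro A hA hsmall
    induction A using Germ.inductionOn with | _ A => ?_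
    rw [absFun_coe, internalIntegral_coe, isStdPart_coe_iff]
    have hA := le_interval_coe_iff.1 hA
    -- On `A` the function is below both a small `δ` and the majorant. Dominated convergence in `(n,
    -- δ)` makes the grid sum of their minimum small.
    have hlim : Tendsto (fun p : ℕ × ℝ => gridSum p.1
        (Finset.Ico (-((p.1 ^ 2 : ℕ) : ℤ)) ((p.1 ^ 2 : ℕ) : ℤ))
        (fun x => min |p.2| (C / (1 + x ^ 2)))) (atTop ×ˢ nhds 0) (nhds 0) := by
      have hfst : Tendsto (Prod.fst : ℕ × ℝ → ℕ) (atTop ×ˢ nhds 0) atTop := tendsto_fst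
      have hsnd : Tendsto (Prod.snd : ℕ × ℝ → ℝ) (atTop ×ˢ nhds 0) (nhds 0) := tendsto_snd
      have h := tendsto_gridSum (n := fun p : ℕ × ℝ => p.1)
        (h := fun p x => min |p.2| (C / (1 + x ^ 2))) (H := fun _ : ℝ => (0 : ℝ)) (C := C) hfst
        (Eventually.of_forall fun p k _ => by
          rw [Real.norm_of_nonneg (by positivity)]
          exact min_le_right _ _) fun x => by
          refine squeeze_zero (fun p => by positivity) (fun p => min_le_left _ _) ?_
          simpa using hsnd.abs
      rwa [integral_zero] at h
    refine tendsto_order.2 ⟨fun a ha => Eventually.of_forall fun i =>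
      ha.trans_le (gridSum_nonneg fun x => norm_nonneg _), fun ε hε => ?_⟩
    obtain ⟨P, hP, Q, hQ, hPQ⟩ := eventually_prod_iff.1 (hlim.eventually_lt_const hε)
    obtain ⟨r, hr, hrQ⟩ := Metric.eventually_nhds_iff.1 hQ
    -- `r / 2` is a fixed positive `δ` that is small enough for `ε` at all large `n`.
    have hδ : Q (r / 2) := hrQ (by
      rw [dist_zero_right, Real.norm_of_nonneg (by positivity)]; linarith)
    filter_upwards [hC, hA, hn.eventually hP, eventually_forall_norm_lt hn hA hsmall (half_pos hr)]
      with i h1 h2 h3 h4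
    refine lt_of_le_of_lt ?_ (hPQ h3 hδ)
    refine gridSum_le_gridSum h2 (fun j hj => le_min ?_ (h1 j (h2 hj))) fun x => by positivity
    exact (h4 j hj).le.trans (le_abs_self _)

/-! ### Pointwise standard parts and the conclusion. -/

/-- At every point, the standard part of the discrete Fourier transform is the value of the
Fourier transform at the standard part of the point. -/
theorem isStdPart_gridFourier {n : ι → ℕ} (hn : Tendsto n U atTop) (g : 𝓢(ℝ, ℂ))
    (x : Rbar ((n ^ 2 : ι → ℕ) : Germ (U : Filter ι) ℕ) (n : Germ (U : Filter ι) ℕ)) :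
    IsStdPart (eval ((fun i => gridFourier g (n i) : ι → ℝ → ℂ) : Germ (U : Filter ι) (ℝ → ℂ)) x.1)
      (extendZero (fourier g) (st x.1)) := by
  obtain ⟨ξ, hx, hfloor⟩ := exists_coe_eq hn x
  rw [hx, eval_coe, isStdPart_coe_iff]
  have hst := tendsto_st (U := U) ξ
  obtain ⟨C, hC0, hC⟩ := exists_norm_gridFourier_le g
  have hinf : Tendsto (fun i => |ξ i|) U atTop →
      Tendsto (fun i => gridFourier g (n i) (ξ i)) U (nhds 0) := by
    intro habs
    have hgrid : Tendsto (fun i => |gridFloor (n i) (ξ i)|) U atTop := by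
      refine tendsto_atTop_mono' _ ?_ (tendsto_atTop_add_const_right _ (-1) habs)
      filter_upwards [eventually_pos hn] with i h0
      have h1 := (abs_gridFloor_sub_le h0 (ξ i)).trans
        ((div_le_one (by positivity)).2 (by exact_mod_cast h0))
      have h2 := abs_sub_abs_le_abs_sub (ξ i) (gridFloor (n i) (ξ i))
      rw [abs_sub_comm] at h2
      linarith
    have hden : Tendsto (fun i => 1 + gridFloor (n i) (ξ i) ^ 2) U atTop := by
      refine tendsto_atTop_add_const_left _ _ ?_
      simpa only [Function.comp_def, sq_abs] using
        (tendsto_pow_atTop (α := ℝ) two_ne_zero).comp hgrid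
    refine squeeze_zero_norm' ?_ (hden.const_div_atTop C)
    filter_upwards [hn.eventually hC, hfloor, eventually_pos hn] with i h1 h2 h0
    -- The decay bound is known only at grid points, and the transform is constant on cells.
    rw [← gridFourier_gridFloor _ h0]
    exact h1 _ h2
  unfold extendZero
  generalize st (ξ : Germ (U : Filter ι) ℝ) = y at hst
  induction y with
  | bot =>
    rw [if_pos (Or.inr rfl)]
    exact hinf (tendsto_abs_atBot_atTop.comp (EReal.tendsto_coe_nhds_bot_iff.1 hst))
  | top =>
    rw [if_pos (Or.inl rfl)]
    exact hinf (tendsto_abs_atTop_atTop.comp (EReal.tendsto_coe_nhds_top_iff.1 hst))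
  | coe t =>
    rw [if_neg (by simp), EReal.toReal_coe]
    have hξ : Tendsto ξ U (nhds t) := EReal.tendsto_coe.1 hst
    have h := (tendsto_gridFourier g t).comp (hn.prodMk hξ)
    simpa only [Function.comp_def] using h

end Loeb

theorem mainTheorem4 {ι : Type*} (U : Ultrafilter ι) (η : Germ (U : Filter ι) ℕ)
    (hη : Loeb.IsInfinite η) (g : 𝓢(ℝ, ℂ)) :
    Loeb.SIntegrable (η ^ 2) η (Loeb.dft η (Loeb.discretize η g)) ∧
    (∀ᵐ x ∂(Loeb.loebMeasure (η ^ 2) η),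
      Loeb.IsStdPart (Loeb.eval (Loeb.dft η (Loeb.discretize η g)) x.1)
        (Loeb.extendZero (Loeb.fourier g) (Loeb.st x.1))) ∧
    Integrable (fun x : Loeb.Rbar (η ^ 2) η => Loeb.extendZero (Loeb.fourier g) (Loeb.st x.1))
      (Loeb.loebMeasure (η ^ 2) η) ∧
    Integrable (Loeb.fourier g) volume ∧
    Loeb.IsStdPart
      (Loeb.internalIntegral η (Loeb.interval (η ^ 2)) (Loeb.dft η (Loeb.discretize η g)))
      (∫ x : Loeb.Rbar (η ^ 2) η, Loeb.extendZero (Loeb.fourier g) (Loeb.st x.1)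
        ∂(Loeb.loebMeasure (η ^ 2) η)) ∧
    ∫ x : Loeb.Rbar (η ^ 2) η, Loeb.extendZero (Loeb.fourier g) (Loeb.st x.1)
        ∂(Loeb.loebMeasure (η ^ 2) η) = ∫ t : ℝ, Loeb.fourier g t := by
  induction η using Germ.inductionOn with | _ n => ?_
  have hn := Loeb.isInfinite_coe_iff.1 hη
  have hint := Loeb.integrable_fourier g
  obtain ⟨C, hC0, hC⟩ := Loeb.exists_norm_gridFourier_le g
  -- Both occurrences of the Loeb integral become the Lebesgue integral, which settles the last
  -- equality.
  rw [← Germ.coe_pow, Loeb.dft_discretize_coe, Loeb.integral_extendZero_st hn hint]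
  refine ⟨Loeb.sIntegrable_of_norm_le hn (Loeb.isCellMeasurable_gridFourier hn g) hC0
    (hn.eventually hC), Eventually.of_forall (Loeb.isStdPart_gridFourier hn g),
    Loeb.integrable_extendZero_st hn hint, hint, ?_, rfl⟩
  rw [Loeb.interval_coe, Loeb.internalIntegral_coe, Loeb.isStdPart_coe_iff]
  simpa only [Function.comp_def, Pi.pow_apply] using (Loeb.tendsto_gridSum_gridFourier g).comp hn
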